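/- Notation. Let $\mathbb{T}^d=\mathbb{R}^d/\mathbb{Z}^d$, let $|\cdot|$ be the Euclidean norm, and for $v:\mathbb{T}^d\to\mathbb{R}^m$ let $\widehat v(k)=\int_{\mathbb{T}^d}v(x)e^{-2\pi i\langle k,x\rangle}\,dx$, $k\in\mathbb{Z}^d$. For an integer $s>d/2$, $H^s(\mathbb{T}^d;\mathbb{R}^m)$ is the space of functions with $\|v\|_{H^s}^2=\sum_{k\in\mathbb{Z}^d}(1+|k|^{2s})|\widehat v(k)|^2<\infty$, each identified with its continuous representative. For $n\ge 1$ let $[[n]]=\{-r,\dots,r\}$ if $n=2r+1$ and $[[n]]=\{-r,\dots,r-1\}$ if $n=2r$. For $N\geq 1$ let $[N]=\{0,\dots,N-1\}$ and $x_n=n/N$ for $n\in[N]^d$; for a grid function $u:[N]^d\to\mathbb{R}^m$ with values $u(x_n)$ let $\mathsf{DFT}(u)(k)=N^{-d}\sum_{n\in[N]^d}u(x_n)e^{-2\pi i\langle k,x_n\rangle}$ and $\|u\|_{\ell^2(n\in[N]^d)}=\big(\sum_{n\in[N]^d}|u(x_n)|^2\big)^{1/2}$. Fourier neural operator (FNO).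 It is given by a number of layers $T$, a mode truncation $K\ge 1$, widths $d_0,\dots,d_T$, a lifting network $\mathcal{P}(u)=\sigma_p(A_pu+b_p)$ from $\mathbb{R}^{d_a}$ to $\mathbb{R}^{d_0}$, and, for $0\le j<T$, activations $\sigma_j:\mathbb{R}^{d_{j+1}}\to\mathbb{R}^{d_{j+1}}$, matrices $W_j\in\mathbb{R}^{d_{j+1}\times d_j}$, biases $b_j\in\mathbb{R}^{d_{j+1}}$ and multipliers $P_j^{(k)}\in\mathbb{C}^{d_{j+1}\times d_j}$, $k\in[[K]]^d$. For an input $a:\mathbb{T}^d\to\mathbb{R}^{d_a}$ the continuum states are $v_0=\mathcal{P}\circ a$ and $$v_{j+1}(x)=\sigma_j\Big(W_jv_j(x)+\sum_{k\in[[K]]^d}P_j^{(k)}\,\widehat{v_j}(k)\,e^{2\pi i\langle k,x\rangle}+b_j\Big),\qquad x\in\mathbb{T}^d .$$ The grid states $v_j^N$ are defined on the points $x_n$, $n\in[N]^d$, by $v_0^N(x_n)=\mathcal{P}(a(x_n))$ and the same recursion with $\widehat{v_j}(k)$ replaced by $\mathsf{DFT}(v_j^N)(k)$ and $x$ by $x_n$.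 In both recursions the real part of the sum over $k$ is taken; this changes nothing when the sum is real-valued. Theorem 1. Let $d,d_a,t\geq 0$ be integers, $s>d/2$ an integer, $B\ge 1$, $M\ge 1$, and let $\mathcal{A}_c$ be a compact subset of $H^s(\mathbb{T}^d;\mathbb{R}^{d_a})$. Then there is a constant $C$, depending only on $B,M,d,s,t$ and $\mathcal{A}_c$ (with its space of inputs), such that the following holds for every FNO as above with $T\ge t$ for which 1. $\sigma_p$ and $\sigma_0,\dots,\sigma_{T-1}$ have continuous derivatives up to order $s$, and those of orders $1,\dots,s$ are bounded by $B$ (in operator norm); 2. $\big(\|A_p\|_F^2+|b_p|^2\big)^{1/2}\le M$, and for $0\le j<T$: $\|W_j\|_2\le M$ (spectral norm), $|b_j|\le M$ and $\big(\sum_{k\in[[K]]^d}\|P_j^{(k)}\|_F^2\big)^{1/2}\le M$. For every integer $N$ with $K<N/2$, $$\sup_{a\in\mathcal{A}_c}\frac{1}{N^{d/2}}\,\|v_t(a)-v_t^N(a)\|_{\ell^2(n\in[N]^d)}\le C\,N^{-s}.$$ -/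

import Mathlib

noncomputable section

namespace FNO

/-- The `d`-dimensional unit torus `ℝᵈ / ℤᵈ`. -/
abbrev Torus (d : ℕ) : Type := UnitAddTorus (Fin d)

/-- `ℝᵐ` with the Euclidean norm. -/
abbrev RVec (m : ℕ) : Type := EuclideanSpace ℝ (Fin m)

/-- `ℂᵐ` with the Euclidean norm. -/
abbrev CVec (m : ℕ) : Type := EuclideanSpace ℂ (Fin m)

/-- Real vectors regarded as complex vectors. -/
def toC {m : ℕ} (v : RVec m) : CVec m := WithLp.toLp 2 fun j => ((v j : ℝ) : ℂ)

/-- Entrywise real part. -/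
def rePart {m : ℕ} (w : CVec m) : RVec m := WithLp.toLp 2 fun j => (w j).re

/-! ### Fourier coefficients and Sobolev spaces on the torus -/

/-- The Fourier coefficient `∫ v(x) exp(-2πi⟨k, x⟩) dx ∈ ℂᵐ` of `v : 𝕋ᵈ → ℝᵐ`. Its `j`-th entry is
the `L²` inner product of `exp(2πi⟨k, ·⟩)` with `vⱼ`, conjugate-linear in the first argument. -/
def fourierCoeff {d m : ℕ} (v : Torus d → RVec m) (k : Fin d → ℤ) : CVec m :=
  WithLp.toLp 2 fun j => UnitAddTorus.mFourierCoeff (fun x => ((v x j : ℝ) : ℂ)) k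

/-- The Sobolev weight `1 + |k|^(2s)`, where `|k|` is the Euclidean norm of `k ∈ ℤᵈ`. -/
def sobolevWeight {d : ℕ} (s : ℕ) (k : Fin d → ℤ) : ℝ := 1 + (∑ i, (k i : ℝ) ^ 2) ^ s

theorem sobolevWeight_pos {d : ℕ} (s : ℕ) (k : Fin d → ℤ) : 0 < sobolevWeight s k := by
  unfold sobolevWeight
  positivity

theorem integrable_aux {d : ℕ} (g : C(Torus d, ℂ)) (k : Fin d → ℤ) :
    MeasureTheory.IntegrableOn
      (fun x : Fin d → ℝ => UnitAddTorus.mFourier (-k) (fun i => (x i : UnitAddCircle)) •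
        g (fun i => (x i : UnitAddCircle)))
      {x : Fin d → ℝ | ∀ i, x i ∈ Set.Ioc ((0 : Fin d → ℝ) i) ((0 : Fin d → ℝ) i + 1)} := by
  have hc : Continuous (fun x : Fin d → ℝ => (fun i => (x i : UnitAddCircle) : Torus d)) :=
    continuous_pi fun i => (AddCircle.continuous_mk' 1).comp (continuous_apply i)
  have hcont : Continuous (fun x : Fin d → ℝ =>
      UnitAddTorus.mFourier (-k) (fun i => (x i : UnitAddCircle)) •
        g (fun i => (x i : UnitAddCircle))) :=
    ((UnitAddTorus.mFourier (-k)).continuous.comp hc).smul (g.continuous.comp hc)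
  refine (hcont.continuousOn.integrableOn_compact
    (isCompact_univ_pi fun _ : Fin d => isCompact_Icc (a := (0 : ℝ)) (b := 1))).mono_set ?_
  intro x hx i _
  have := hx i
  simp only [Pi.zero_apply, zero_add] at this
  exact ⟨this.1.le, this.2⟩

theorem mFourierCoeff_add {d : ℕ} (f g : C(Torus d, ℂ)) (k : Fin d → ℤ) :
    UnitAddTorus.mFourierCoeff (fun x => f x + g x) k =
      UnitAddTorus.mFourierCoeff f k + UnitAddTorus.mFourierCoeff g k := by
  simp only [UnitAddTorus.mFourierCoeff_eq_integral _ k 0]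
  rw [← MeasureTheory.integral_add (integrable_aux f k) (integrable_aux g k)]
  simp only [smul_add]

/-- The `j`-th component of a continuous vector-valued function, as a complex function. -/
def comp {d m : ℕ} (f : C(Torus d, RVec m)) (j : Fin m) : C(Torus d, ℂ) where
  toFun x := ((f x j : ℝ) : ℂ)
  continuous_toFun := by fun_prop

theorem fourierCoeff_add {d m : ℕ} (f g : C(Torus d, RVec m)) (k : Fin d → ℤ) :
    fourierCoeff (⇑(f + g)) k = fourierCoeff f k + fourierCoeff g k := by
  ext j
  have h := mFourierCoeff_add (comp f j) (comp g j) k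
  simpa [fourierCoeff, comp] using h

theorem fourierCoeff_smul {d m : ℕ} (c : ℝ) (f : C(Torus d, RVec m)) (k : Fin d → ℤ) :
    fourierCoeff (⇑(c • f)) k = c • fourierCoeff f k := by
  ext j
  simp only [fourierCoeff, UnitAddTorus.mFourierCoeff, PiLp.smul_apply]
  rw [← MeasureTheory.integral_smul]
  congr 1
  ext x
  simp
  ring

/-- The Fourier coefficients weighted by `(1 + |k|^(2s))^(1/2)`. -/
def weightedCoeff {d m : ℕ} (s : ℕ) (f : C(Torus d, RVec m)) (k : Fin d → ℤ) : CVec m :=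
  Real.sqrt (sobolevWeight s k) • fourierCoeff f k

theorem norm_weightedCoeff_sq {d m : ℕ} (s : ℕ) (f : C(Torus d, RVec m)) (k : Fin d → ℤ) :
    ‖weightedCoeff s f k‖ ^ 2 = sobolevWeight s k * ‖fourierCoeff f k‖ ^ 2 := by
  rw [weightedCoeff, norm_smul, mul_pow, Real.norm_of_nonneg (Real.sqrt_nonneg _),
    Real.sq_sqrt (sobolevWeight_pos s k).le]

theorem memlp_iff {d m : ℕ} (s : ℕ) (f : C(Torus d, RVec m)) :
    Memℓp (weightedCoeff s f) 2 ↔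
      Summable fun k : Fin d → ℤ => sobolevWeight s k * ‖fourierCoeff f k‖ ^ 2 := by
  rw [memℓp_gen_iff (by simp)]
  simp only [ENNReal.toReal_ofNat, Real.rpow_ofNat, norm_weightedCoeff_sq]

theorem weightedCoeff_add {d m : ℕ} (s : ℕ) (f g : C(Torus d, RVec m)) :
    weightedCoeff s (f + g) = weightedCoeff s f + weightedCoeff s g := by
  funext k
  simp only [weightedCoeff, fourierCoeff_add, smul_add, Pi.add_apply]

theorem weightedCoeff_smul {d m : ℕ} (s : ℕ) (c : ℝ) (f : C(Torus d, RVec m)) :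
    weightedCoeff s (c • f) = c • weightedCoeff s f := by
  funext k
  simp only [weightedCoeff, fourierCoeff_smul, Pi.smul_apply]
  rw [smul_comm]

/-- The functions `f` with `∑ₖ (1 + |k|^(2s)) |f̂(k)|² < ∞`, each given by its continuous
representative. For `s > d / 2` every such square-integrable function has exactly one
continuous representative, which is the one that is evaluated on grids. -/
def sobolevSubmodule (d m s : ℕ) : Submodule ℝ C(Torus d, RVec m) where
  carrier := {f | Summable fun k : Fin d → ℤ => sobolevWeight s k * ‖fourierCoeff f k‖ ^ 2}
  zero_mem' := by
    rw [Set.mem_ofPred_eq, ← memlp_iff]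
    have h : weightedCoeff s (0 : C(Torus d, RVec m)) = 0 := by
      have h0 := weightedCoeff_smul s 0 (0 : C(Torus d, RVec m))
      have e : (0 : ℝ) • (0 : C(Torus d, RVec m)) = 0 := by
        ext x
        simp
      rwa [e, zero_smul] at h0
    rw [h]
    exact zero_memℓp
  add_mem' := by
    intro f g hf hg
    rw [Set.mem_ofPred_eq, ← memlp_iff] at hf hg ⊢
    rw [weightedCoeff_add]
    exact hf.add hg
  smul_mem' := by
    intro c f hf
    rw [Set.mem_ofPred_eq, ← memlp_iff] at hf ⊢
    rw [weightedCoeff_smul]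
    exact hf.const_smul c

/-- The Sobolev space `Hˢ(𝕋ᵈ; ℝᵐ)`, `s > d / 2`. A type of its own, because it carries the
`Hˢ` norm below and not the supremum norm of `C(𝕋ᵈ; ℝᵐ)`. -/
def Sobolev (d m s : ℕ) : Type := sobolevSubmodule d m s

instance (d m s : ℕ) : AddCommGroup (Sobolev d m s) :=
  inferInstanceAs (AddCommGroup (sobolevSubmodule d m s))

instance (d m s : ℕ) : Module ℝ (Sobolev d m s) :=
  inferInstanceAs (Module ℝ (sobolevSubmodule d m s))

/-- The underlying continuous function. -/
def Sobolev.toCont {d m s : ℕ} (f : Sobolev d m s) : C(Torus d, RVec m) := f.1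

/-- The embedding of `Hˢ` into `ℓ²(ℤᵈ; ℂᵐ)` by weighted Fourier coefficients. -/
def Sobolev.toEll2 (d m s : ℕ) :
    Sobolev d m s →ₗ[ℝ] lp (fun _ : Fin d → ℤ => CVec m) 2 where
  toFun f := ⟨weightedCoeff s f.toCont, (memlp_iff s f.toCont).2 f.2⟩
  map_add' f g := Subtype.ext (weightedCoeff_add s f.toCont g.toCont)
  map_smul' c f := Subtype.ext (weightedCoeff_smul s c f.toCont)

theorem Sobolev.toEll2_injective (d m s : ℕ) : Function.Injective (Sobolev.toEll2 d m s) := by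
  rw [injective_iff_map_eq_zero]
  intro f hf
  have hw : ∀ k, fourierCoeff f.toCont k = 0 := by
    intro k
    have h1 : weightedCoeff s f.toCont k = 0 := congrFun (congrArg Subtype.val hf) k
    rw [weightedCoeff, smul_eq_zero] at h1
    exact h1.resolve_left (Real.sqrt_pos.2 (sobolevWeight_pos s k)).ne'
  have hz : f.toCont = 0 := by
    ext x j
    have hc : UnitAddTorus.mFourierCoeff (comp f.toCont j) = 0 := by
      funext k
      exact congrArg (fun w : CVec m => w j) (hw k)
    have hs := UnitAddTorus.hasSum_mFourier_series_apply_of_summable (f := comp f.toCont j)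
      (by rw [hc]; exact summable_zero) x
    rw [hc] at hs
    have hzero : (fun i : Fin d → ℤ => (0 : (Fin d → ℤ) → ℂ) i • UnitAddTorus.mFourier i x) =
        fun _ => (0 : ℂ) := by
      funext i
      simp
    rw [hzero] at hs
    have h0 := hs.unique hasSum_zero
    simpa [comp] using h0
  exact Subtype.ext hz

/-- The norm of `Hˢ`: `‖f‖² = ∑ₖ (1 + |k|^(2s)) |f̂(k)|²`. -/
instance (d m s : ℕ) : NormedAddCommGroup (Sobolev d m s) :=
  NormedAddCommGroup.induced _ _ (Sobolev.toEll2 d m s) (Sobolev.toEll2_injective d m s)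

theorem Sobolev.norm_sq {d m s : ℕ} (f : Sobolev d m s) :
    ‖f‖ ^ 2 = ∑' k : Fin d → ℤ, sobolevWeight s k * ‖fourierCoeff f.toCont k‖ ^ 2 := by
  have h := lp.norm_rpow_eq_tsum (p := 2) (by simp) (Sobolev.toEll2 d m s f)
  simp only [ENNReal.toReal_ofNat, Real.rpow_ofNat] at h
  refine h.trans (tsum_congr fun k => ?_)
  exact norm_weightedCoeff_sq s f.toCont k

/-! ### Grids and the discrete Fourier transform -/

/-- The set `[[n]] ⊆ ℤ`: `{-r, …, r}` if `n = 2r + 1` and `{-r, …, r - 1}` if `n = 2r`. -/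
def symIndex (n : ℕ) : Finset ℤ := Finset.Ico (-((n / 2 : ℕ) : ℤ)) (((n + 1) / 2 : ℕ) : ℤ)

/-- The set `[[n]]ᵈ ⊆ ℤᵈ`. -/
def symIndexBox (d n : ℕ) : Finset (Fin d → ℤ) := Fintype.piFinset fun _ => symIndex n

/-- The grid point `xₙ = n / N` of the torus, `n ∈ {0, …, N - 1}ᵈ`. -/
def gridPoint {d N : ℕ} (n : Fin d → Fin N) : Torus d :=
  fun i => ((((n i : ℕ) : ℝ) / (N : ℝ) : ℝ) : UnitAddCircle)

/-- The discrete Fourier transform `N⁻ᵈ ∑ₙ v(xₙ) exp(-2πi⟨k, xₙ⟩)` of a grid function. -/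
def dft {d N m : ℕ} (v : (Fin d → Fin N) → RVec m) (k : Fin d → ℤ) : CVec m :=
  ((N : ℂ) ^ d)⁻¹ • ∑ n, UnitAddTorus.mFourier (-k) (gridPoint n) • toC (v n)

/-- The discrete norm `‖u‖ = (∑ₙ |u(xₙ)|²)^(1/2)` of a grid function. -/
def ell2Norm {d N m : ℕ} (u : (Fin d → Fin N) → RVec m) : ℝ := Real.sqrt (∑ n, ‖u n‖ ^ 2)

/-! ### Fourier neural operators -/

/-- The lifting map and the hidden layers of a Fourier neural operator with inputs
`𝕋ᵈ → ℝ^(dₐ)`. The final projection is left out, since it does not enter the states.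
The data of layer `t` matter for `t < depth` only. Activations are arbitrary maps of `ℝᵐ`, acting
pointwise in `x`; scalar activations applied to each component are a special case. -/
structure Model (d da : ℕ) where
  /-- number `T` of hidden layers -/
  depth : ℕ
  /-- mode truncation `K` -/
  modes : ℕ
  /-- channel widths `d₀, …, d_T` -/
  width : ℕ → ℕ
  /-- activation `σₚ` of the lifting network -/
  liftAct : RVec (width 0) → RVec (width 0)
  /-- matrix of the lifting network -/
  liftMat : Matrix (Fin (width 0)) (Fin da) ℝ
  /-- bias of the lifting network -/
  liftBias : RVec (width 0)
  /-- layer activations `σₜ` -/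
  act : ∀ t, RVec (width (t + 1)) → RVec (width (t + 1))
  /-- layer matrices `Wₜ` -/
  weight : ∀ t, Matrix (Fin (width (t + 1))) (Fin (width t)) ℝ
  /-- layer biases `bₜ` -/
  bias : ∀ t, RVec (width (t + 1))
  /-- Fourier multipliers `Pₜ⁽ᵏ⁾`, used for `k ∈ [[K]]ᵈ` only -/
  mult : ∀ t, (Fin d → ℤ) → Matrix (Fin (width (t + 1))) (Fin (width t)) ℂ

namespace Model

variable {d da : ℕ}

/-- The lifting network `u ↦ σₚ(A u + b)`. -/
def lift (F : Model d da) (u : RVec da) : RVec (F.width 0) :=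
  F.liftAct (Matrix.toEuclideanLin F.liftMat u + F.liftBias)

/-- The function `x ↦ ∑_{k ∈ [[K]]ᵈ} Pₜ⁽ᵏ⁾ c(k) exp(2πi⟨k, x⟩)` for coefficients `c`. Its values
are real when the multipliers make the layer real-valued; the real part is then the identity. -/
def synth (F : Model d da) (t : ℕ) (c : (Fin d → ℤ) → CVec (F.width t)) (x : Torus d) :
    RVec (F.width (t + 1)) :=
  rePart (∑ k ∈ symIndexBox d F.modes,
    UnitAddTorus.mFourier k x • Matrix.toEuclideanLin (F.mult t k) (c k))

/-- The continuum kernel operator `𝒦ₜ`. -/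
def kernel (F : Model d da) (t : ℕ) (v : Torus d → RVec (F.width t)) :
    Torus d → RVec (F.width (t + 1)) :=
  F.synth t (fourierCoeff v)

/-- The grid kernel operator `𝒦ₜᴺ`: the same with the discrete Fourier transform. -/
def gridKernel (F : Model d da) (N t : ℕ) (v : (Fin d → Fin N) → RVec (F.width t)) :
    (Fin d → Fin N) → RVec (F.width (t + 1)) :=
  fun n => F.synth t (dft v) (gridPoint n)

/-- The continuum states: `v₀ = 𝒫(a)`, `vₜ₊₁ = σₜ(Wₜ vₜ + 𝒦ₜ vₜ + bₜ)`. -/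
def state (F : Model d da) (a : Torus d → RVec da) : ∀ t, Torus d → RVec (F.width t)
  | 0 => fun x => F.lift (a x)
  | t + 1 => fun x => F.act t (Matrix.toEuclideanLin (F.weight t) (F.state a t x) +
      F.kernel t (F.state a t) x + F.bias t)

/-- The states of the discretized operator on the grid with `Nᵈ` points. -/
def gridState (F : Model d da) (N : ℕ) (a : Torus d → RVec da) :
    ∀ t, (Fin d → Fin N) → RVec (F.width t)
  | 0 => fun n => F.lift (a (gridPoint n))
  | t + 1 => fun n => F.act t (Matrix.toEuclideanLin (F.weight t) (F.gridState N a t n) +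
      F.gridKernel N t (F.gridState N a t) n + F.bias t)

end Model

/-- `σ` has continuous derivatives up to order `s`, and those of orders `1, …, s` are bounded by `B`
(in operator norm; for a scalar function applied to each component this is a bound
on the derivatives of the scalar function). -/
def BoundedDerivatives {m : ℕ} (s : ℕ) (B : ℝ) (σ : RVec m → RVec m) : Prop :=
  ContDiff ℝ s σ ∧ ∀ j, 1 ≤ j → j ≤ s → ∀ x, ‖iteratedFDeriv ℝ j σ x‖ ≤ B

/-- Squared Frobenius norm of a matrix. -/
def frobSq {𝕜 : Type*} [RCLike 𝕜] {m n : ℕ} (A : Matrix (Fin m) (Fin n) 𝕜) : ℝ :=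
  ∑ i, ∑ j, ‖A i j‖ ^ 2

/-- The standing assumptions: derivatives of all activations bounded by `B`, and
all parameters bounded by `M`. -/
structure Model.Admissible {d da : ℕ} (F : Model d da) (s : ℕ) (B M : ℝ) : Prop where
  liftAct_bound : BoundedDerivatives s B F.liftAct
  act_bound : ∀ t < F.depth, BoundedDerivatives s B (F.act t)
  lift_bound : Real.sqrt (frobSq F.liftMat + ‖F.liftBias‖ ^ 2) ≤ M
  weight_bound : ∀ t < F.depth,
    ‖LinearMap.toContinuousLinearMap (Matrix.toEuclideanLin (F.weight t))‖ ≤ M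
  bias_bound : ∀ t < F.depth, ‖F.bias t‖ ≤ M
  mult_bound : ∀ t < F.depth,
    Real.sqrt (∑ k ∈ symIndexBox d F.modes, frobSq (F.mult t k)) ≤ M

end FNO

end

/-! A layer is discretized only by replacing Fourier coefficients with discrete ones. The new error
per layer is therefore an aliasing error, of order N^{-s} as long as the energy ∑|k|^{2s}|v̂(k)|² of
the states is bounded independently of the model. Two things are needed: regularity survives every
layer, and errors propagate with constants free of widths and modes.

Regularity. The nonlinear point is composition with σ. By Faà di Bruno, the s-th derivative of σ ∘ f
along a coordinate is controlled by products of lower pure derivatives of f. Gagliardo–Nirenberg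
(`exists_integral_iterate_pderiv_le`) bounds the j-th one in L^{2s/j} through the oscillation of f
and the L² norm of the s-th one. Since the values of σ are not bounded, `SobolevBound` records the
deviation from some constant instead of a supremum norm. For the kernel term, s > d/2 makes
∑|k|^{-2s} finite, so the energy bounds the oscillation whatever the number of modes.

Error. K < N/2 forces |kᵢ| ≤ N/4, so an alias k + Nq with q ≠ 0 has size at least N|q|/2, and
Cauchy–Schwarz bounds the sum over aliases by C N^{-s} (`exists_norm_fourierCoeff_sub_dft_le`).
Discrete Parseval and the square-summed Frobenius norms of the multipliers turn this bound, uniform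
in k, into an ℓ² bound on the grid. The Lipschitz bound for σ then closes the recursion
(`exists_state_bound`).

Inputs in Hˢ need not be Cˢ. They are uniform limits of trigonometric polynomials of no larger
energy. For a fixed model and grid the states are Lipschitz in the input, and the constant of the
error bound sees only the energy, so the bound passes to the limit. -/

namespace FNO

noncomputable section

open MeasureTheory Filter Topology
open scoped ContDiff Nat

/-! ### Calculus on the torus -/

section Calculus

variable {d : ℕ} {E G : Type*} [NormedAddCommGroup E] [NormedSpace ℝ E]
  [NormedAddCommGroup G] [NormedSpace ℝ G]

/-- The Haar probability measure on the torus. -/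
abbrev haar (d : ℕ) : Measure (Torus d) := Measure.pi fun _ => AddCircle.haarAddCircle

/-- The covering map `ℝᵈ → 𝕋ᵈ`. -/
def mk (y : Fin d → ℝ) : Torus d := fun i => (y i : UnitAddCircle)

theorem isOpenQuotientMap_mk : IsOpenQuotientMap (mk : (Fin d → ℝ) → Torus d) :=
  IsOpenQuotientMap.piMap (f := fun _ : Fin d => ((↑) : ℝ → UnitAddCircle))
    fun _ => QuotientAddGroup.isOpenQuotientMap_mk

/-- Translation by `τ` in the `i`-th coordinate direction. -/
def shift (i : Fin d) (x : Torus d) (τ : ℝ) : Torus d := x + Pi.single i (τ : UnitAddCircle)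

theorem shift_mk (i : Fin d) (y : Fin d → ℝ) (τ : ℝ) :
    shift i (mk y) τ = mk (y + τ • Pi.single i 1) := by
  funext j
  by_cases h : j = i
  · subst h
    simp [shift, mk]
  · simp [shift, mk, h]

@[simp] theorem shift_zero (i : Fin d) (x : Torus d) : shift i x 0 = x := by simp [shift]

@[simp] theorem shift_one (i : Fin d) (x : Torus d) : shift i x 1 = x := by
  have : ((1 : ℝ) : UnitAddCircle) = 0 := AddCircle.coe_period 1
  simp [shift, this]

theorem continuous_shift (i : Fin d) : Continuous fun p : Torus d × ℝ => shift i p.1 p.2 := by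
  unfold shift
  have h : Continuous fun p : Torus d × ℝ => (Pi.single i (p.2 : UnitAddCircle) : Torus d) :=
    (continuous_single i).comp ((AddCircle.continuous_mk' 1).comp continuous_snd)
  exact continuous_fst.add h

/-- A function on the torus is `Cⁿ` if its periodic lift to `ℝᵈ` is. -/
def IsSmooth (n : ℕ) (f : Torus d → E) : Prop := ContDiff ℝ n fun y : Fin d → ℝ => f (mk y)

/-- The partial derivative in the `i`-th coordinate direction. -/
def pderiv (i : Fin d) (f : Torus d → E) (x : Torus d) : E := deriv (fun τ => f (shift i x τ)) 0

theorem IsSmooth.of_le {n k : ℕ} {f : Torus d → E} (h : IsSmooth n f) (hk : k ≤ n) :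
    IsSmooth k f :=
  ContDiff.of_le h (by exact_mod_cast hk)

theorem IsSmooth.continuous {n : ℕ} {f : Torus d → E} (h : IsSmooth n f) : Continuous f :=
  isOpenQuotientMap_mk.isQuotientMap.continuous_iff.2 (ContDiff.continuous h)

theorem IsSmooth.hasDerivAt_mk {f : Torus d → E} (h : IsSmooth 1 f) (i : Fin d)
    (y : Fin d → ℝ) (τ : ℝ) :
    HasDerivAt (fun τ => f (shift i (mk y) τ))
      (fderiv ℝ (fun y => f (mk y)) (y + τ • Pi.single i 1) (Pi.single i 1)) τ := by
  have h1 : HasDerivAt (fun τ : ℝ => y + τ • (Pi.single i 1 : Fin d → ℝ)) (Pi.single i 1) τ := by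
    simpa using ((hasDerivAt_id τ).smul_const (Pi.single i 1 : Fin d → ℝ)).const_add y
  have h2 := (ContDiff.differentiable h (by simp)).differentiableAt
    (x := y + τ • (Pi.single i 1 : Fin d → ℝ))
  have h3 := h2.hasFDerivAt.comp_hasDerivAt τ h1
  simp only [shift_mk]
  exact h3

theorem IsSmooth.pderiv_mk {f : Torus d → E} (h : IsSmooth 1 f) (i : Fin d)
    (y : Fin d → ℝ) :
    pderiv i f (mk y) = fderiv ℝ (fun y => f (mk y)) y (Pi.single i 1) := by
  unfold pderiv
  simpa using (h.hasDerivAt_mk i y 0).deriv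

theorem IsSmooth.hasDerivAt {f : Torus d → E} (h : IsSmooth 1 f) (i : Fin d)
    (x : Torus d) (τ : ℝ) :
    HasDerivAt (fun τ => f (shift i x τ)) (pderiv i f (shift i x τ)) τ := by
  obtain ⟨y, rfl⟩ := isOpenQuotientMap_mk.surjective x
  rw [shift_mk, h.pderiv_mk]
  exact h.hasDerivAt_mk i y τ

theorem IsSmooth.pderiv {n : ℕ} {f : Torus d → E} (h : IsSmooth (n + 1) f) (i : Fin d) :
    IsSmooth n (pderiv i f) := by
  unfold IsSmooth
  simp only [(h.of_le (Nat.le_add_left 1 n)).pderiv_mk]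
  have h1 := ContDiff.fderiv_right (m := n) (n := (n + 1 : ℕ)) h (by norm_cast)
  exact h1.clm_apply contDiff_const

theorem IsSmooth.iterate_pderiv {n j : ℕ} {f : Torus d → E} (h : IsSmooth n f) (hj : j ≤ n)
    (i : Fin d) : IsSmooth (n - j) ((FNO.pderiv i)^[j] f) := by
  induction j with
  | zero => exact h
  | succ j ih =>
    rw [Function.iterate_succ_apply']
    have := ih (by omega)
    rw [show n - j = (n - (j + 1)) + 1 by omega] at this
    exact this.pderiv i

theorem pderiv_eq_of_hasDerivAt {f : Torus d → E} {i : Fin d} {x : Torus d} {v : E}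
    (h : HasDerivAt (fun τ => f (shift i x τ)) v 0) : pderiv i f x = v :=
  h.deriv

theorem IsSmooth.hasDerivAt_zero {f : Torus d → E} (h : IsSmooth 1 f) (i : Fin d)
    (x : Torus d) :
    HasDerivAt (fun τ => f (shift i x τ)) (FNO.pderiv i f x) 0 := by
  simpa using h.hasDerivAt i x 0

theorem IsSmooth.contDiff_line {n : ℕ} {f : Torus d → E} (h : IsSmooth n f) (i : Fin d)
    (x : Torus d) : ContDiff ℝ n fun τ => f (shift i x τ) := by
  obtain ⟨y, rfl⟩ := isOpenQuotientMap_mk.surjective x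
  simp only [shift_mk]
  exact ContDiff.comp (g := fun y : Fin d → ℝ => f (mk y)) h
    (contDiff_const.add (contDiff_id.smul contDiff_const))

/-- Reduces pure partial derivatives on the torus to one real variable, where the chain rule
estimate for higher derivatives applies. -/
theorem IsSmooth.iteratedDeriv_line {n : ℕ} {f : Torus d → E} (h : IsSmooth n f) (i : Fin d)
    (x : Torus d) :
    iteratedDeriv n (fun τ => f (shift i x τ)) = fun τ => (FNO.pderiv i)^[n] f (shift i x τ) := by
  induction n with
  | zero => simp
  | succ n ih =>
    rw [iteratedDeriv_succ, ih (h.of_le (Nat.le_succ n)), Function.iterate_succ_apply']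
    funext τ
    have h1 := h.iterate_pderiv (Nat.le_succ n) i
    rw [show n + 1 - n = 1 by omega] at h1
    exact (h1.hasDerivAt i x τ).deriv

theorem integrable_of_continuous {F : Type*} [NormedAddCommGroup F] {f : Torus d → F}
    (h : Continuous f) : Integrable f (haar d) := by
  have := h.continuousOn.integrableOn_compact (μ := haar d) isCompact_univ
  simpa using this

theorem integrable_uncurry_uIoc {X : Type*} [TopologicalSpace X] [CompactSpace X]
    [MeasurableSpace X] [BorelSpace X] [SecondCountableTopology X] [T2Space X] (μ : Measure X)
    [IsFiniteMeasure μ] {F : Type*} [NormedAddCommGroup F] {f : ℝ × X → F}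
    (hf : Continuous f) (a b : ℝ) :
    Integrable f ((volume.restrict (Set.uIoc a b)).prod μ) := by
  have h1 : IntegrableOn f (Set.uIcc a b ×ˢ Set.univ) ((volume : Measure ℝ).prod μ) :=
    hf.continuousOn.integrableOn_compact (isCompact_uIcc.prod isCompact_univ)
  have h2 := h1.mono_set (Set.prod_mono_left (t := Set.univ) Set.uIoc_subset_uIcc)
  rwa [IntegrableOn, ← Measure.prod_restrict, Measure.restrict_univ] at h2

/-- Haar measure is translation invariant, so the integral may be averaged over shifts τ ∈ [0, 1].
After Fubini, the inner integral runs over a closed loop and vanishes. This is the source of every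
integration by parts below and of the orthogonality of characters. -/
theorem integral_pderiv [CompleteSpace E] {f : Torus d → E} (h : IsSmooth 1 f) (i : Fin d) :
    ∫ x, pderiv i f x ∂(haar d) = 0 := by
  have hc : Continuous (pderiv i f) := (IsSmooth.pderiv (n := 0) h i).continuous
  have hc2 : Continuous fun p : ℝ × Torus d => pderiv i f (shift i p.2 p.1) :=
    hc.comp ((continuous_shift i).comp continuous_swap)
  have h1 : ∀ τ : ℝ, ∫ x, pderiv i f (shift i x τ) ∂(haar d) = ∫ x, pderiv i f x ∂(haar d) :=
    fun τ => integral_add_right_eq_self (pderiv i f) _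
  have h2 : ∫ τ in (0 : ℝ)..1, ∫ x, pderiv i f (shift i x τ) ∂(haar d) =
      ∫ x, (∫ τ in (0 : ℝ)..1, pderiv i f (shift i x τ)) ∂(haar d) := by
    refine intervalIntegral_integral_swap (f := fun τ x => pderiv i f (shift i x τ)) ?_
    exact integrable_uncurry_uIoc (haar d) hc2 0 1
  have h3 : ∀ x, ∫ τ in (0 : ℝ)..1, pderiv i f (shift i x τ) = 0 := by
    intro x
    rw [intervalIntegral.integral_eq_sub_of_hasDerivAt (fun τ _ => h.hasDerivAt i x τ)]
    · simp
    · have hl : Continuous fun τ : ℝ => pderiv i f (shift i x τ) :=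
        hc2.comp (continuous_id.prodMk continuous_const)
      exact hl.intervalIntegrable _ _
  simp only [h1, h3] at h2
  simpa using h2

theorem IsSmooth.const (n : ℕ) (c : E) : IsSmooth n fun _ : Torus d => c := contDiff_const

theorem IsSmooth.add {n : ℕ} {f g : Torus d → E} (hf : IsSmooth n f) (hg : IsSmooth n g) :
    IsSmooth n fun x => f x + g x := ContDiff.add hf hg

theorem IsSmooth.comp {n : ℕ} {f : Torus d → E} {g : E → G} (hg : ContDiff ℝ n g)
    (hf : IsSmooth n f) : IsSmooth n fun x => g (f x) := ContDiff.comp hg hf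

theorem iterate_pderiv_add {n : ℕ} {f g : Torus d → E} (hf : IsSmooth n f) (hg : IsSmooth n g)
    (i : Fin d) : (pderiv i)^[n] (fun x => f x + g x) =
      fun x => (pderiv i)^[n] f x + (pderiv i)^[n] g x := by
  induction n generalizing f g with
  | zero => rfl
  | succ n ih =>
    simp only [Function.iterate_succ_apply]
    rw [← ih (hf.pderiv i) (hg.pderiv i)]
    congr 1
    funext x
    exact pderiv_eq_of_hasDerivAt (((hf.of_le (by omega)).hasDerivAt_zero i x).add
      ((hg.of_le (by omega)).hasDerivAt_zero i x))

theorem iterate_pderiv_clm {n : ℕ} {f : Torus d → E} (L : E →L[ℝ] G) (hf : IsSmooth n f)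
    (i : Fin d) : (pderiv i)^[n] (fun x => L (f x)) = fun x => L ((pderiv i)^[n] f x) := by
  induction n generalizing f with
  | zero => rfl
  | succ n ih =>
    simp only [Function.iterate_succ_apply]
    rw [← ih (hf.pderiv i)]
    congr 1
    funext x
    exact pderiv_eq_of_hasDerivAt
      (L.hasFDerivAt.comp_hasDerivAt _ ((hf.of_le (by omega)).hasDerivAt_zero i x))

theorem iterate_pderiv_const (n : ℕ) (c : E) (i : Fin d) :
    (pderiv i)^[n + 1] (fun _ : Torus d => c) = fun _ => 0 := by
  induction n with
  | zero =>
    funext x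
    simp [pderiv]
  | succ n ih =>
    rw [Function.iterate_succ_apply', ih]
    funext x
    simp [pderiv]

end Calculus

/-! ### The Gagliardo–Nirenberg inequality on the torus -/

section GagliardoNirenberg

variable {d : ℕ} {E : Type*} [NormedAddCommGroup E] [InnerProductSpace ℝ E]

/-- A Young inequality whose factor 1/2 allows the b-term to be absorbed. If 2κac ≤ b², the first
summand suffices; otherwise b is bounded by a power of ac and the second does. -/
theorem mul_rpow_mul_le {κ a b c q : ℝ} (hκ : 0 ≤ κ) (ha : 0 ≤ a) (hb : 0 ≤ b) (hc : 0 ≤ c)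
    (hq : 0 < q) :
    κ * (a * b ^ q * c) ≤
      1 / 2 * b ^ (q + 2) + κ * (2 * κ) ^ (q / 2) * (a * c) ^ ((q + 2) / 2) := by
  have hbq : 0 ≤ b ^ q := Real.rpow_nonneg hb q
  have hb2 : b ^ (q + 2) = b ^ q * b ^ 2 := by
    rw [Real.rpow_add_of_nonneg hb hq.le (by norm_num)]
    norm_num
  have hac : 0 ≤ a * c := mul_nonneg ha hc
  have hK : 0 ≤ κ * (2 * κ) ^ (q / 2) * (a * c) ^ ((q + 2) / 2) := by positivity
  rcases le_total (2 * κ * (a * c)) (b ^ 2) with h | h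
  · have := mul_le_mul_of_nonneg_left h hbq
    rw [hb2]
    nlinarith
  · have h1 : b ^ q ≤ (2 * κ * (a * c)) ^ (q / 2) := by
      have h2 : b ^ q = (b ^ 2) ^ (q / 2) := by
        rw [← Real.rpow_natCast b 2, ← Real.rpow_mul hb]
        congr 1
        push_cast
        ring
      rw [h2]
      exact Real.rpow_le_rpow (by positivity) h (by positivity)
    have h3 : (2 * κ * (a * c)) ^ (q / 2) * (a * c) = (2 * κ) ^ (q / 2) * (a * c) ^ ((q + 2) / 2) := by
      rw [Real.mul_rpow (by positivity) hac, show (q + 2) / 2 = q / 2 + 1 by ring,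
        Real.rpow_add_of_nonneg hac (by positivity) zero_le_one, Real.rpow_one]
      ring
    have h4 : 0 ≤ b ^ (q + 2) := Real.rpow_nonneg hb _
    calc κ * (a * b ^ q * c) = κ * (b ^ q * (a * c)) := by ring
      _ ≤ κ * ((2 * κ * (a * c)) ^ (q / 2) * (a * c)) := by gcongr
      _ = κ * (2 * κ) ^ (q / 2) * (a * c) ^ ((q + 2) / 2) := by rw [h3]; ring
      _ ≤ _ := by linarith

theorem exists_rpow_mul_rpow_le {θ δ : ℝ} (h0 : 0 < θ) (h1 : θ < 1) (hδ : 0 < δ) :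
    ∃ C, 0 ≤ C ∧ ∀ X Y : ℝ, 0 ≤ X → 0 ≤ Y → X ^ θ * Y ^ (1 - θ) ≤ δ * X + C * Y := by
  -- The exponent makes the powers of δ cancel in the weighted geometric mean of δX and CY.
  refine ⟨(δ ^ (-θ / (1 - θ))), by positivity, fun X Y hX hY => ?_⟩
  have h1' : 0 < 1 - θ := by linarith
  have h := Real.geom_mean_le_arith_mean2_weighted h0.le h1'.le
    (mul_nonneg hδ.le hX) (mul_nonneg (Real.rpow_nonneg hδ.le (-θ / (1 - θ))) hY) (by ring)
  rw [Real.mul_rpow hδ.le hX, Real.mul_rpow (by positivity) hY, ← Real.rpow_mul hδ.le,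
    div_mul_cancel₀ _ h1'.ne', Real.rpow_neg hδ.le] at h
  have h2 : δ ^ θ ≠ 0 := (Real.rpow_pos_of_pos hδ θ).ne'
  have h3 : δ ^ θ * X ^ θ * ((δ ^ θ)⁻¹ * Y ^ (1 - θ)) = X ^ θ * Y ^ (1 - θ) := by
    field_simp
  rw [h3] at h
  refine h.trans (add_le_add ?_ ?_)
  · exact mul_le_of_le_one_left (by positivity) h1.le
  · exact mul_le_of_le_one_left (by positivity) (by linarith)

/-- With w = ∂u, the derivative of (|w|² + ε)^{q/2}⟨u, w⟩ integrates to zero. It contains the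
integrand on the left, and its other terms are bounded by Cauchy–Schwarz and |w|² ≤ |w|² + ε. The
regularization by ε keeps the power differentiable where w vanishes, even for small q. -/
theorem integral_rpow_pderiv_le_of_pos {u : Torus d → E} (hu : IsSmooth 2 u) (i : Fin d) {q : ℝ}
    (hq : 0 < q) {ε : ℝ} (hε : 0 < ε) :
    ∫ x, (‖pderiv i u x‖ ^ 2 + ε) ^ (q / 2) * ‖pderiv i u x‖ ^ 2 ∂(haar d) ≤
      ∫ x, (q + 1) * (‖u x‖ * (‖pderiv i u x‖ ^ 2 + ε) ^ (q / 2) * ‖pderiv i (pderiv i u) x‖)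
        ∂(haar d) := by
  have hw : IsSmooth 1 (pderiv i u) := hu.pderiv i
  have hz : IsSmooth 0 (pderiv i (pderiv i u)) := hw.pderiv i
  have hpos : ∀ x, 0 < ‖pderiv i u x‖ ^ 2 + ε := fun x => by positivity
  have hρ : IsSmooth 1 fun x => ‖pderiv i u x‖ ^ 2 + ε :=
    IsSmooth.add (ContDiff.norm_sq ℝ hw) (IsSmooth.const 1 ε)
  have hφ : IsSmooth 1 fun x => (‖pderiv i u x‖ ^ 2 + ε) ^ (q / 2) * inner ℝ (u x) (pderiv i u x) :=
    ContDiff.mul (ContDiff.rpow_const_of_ne hρ fun x => (hpos _).ne')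
      (ContDiff.inner ℝ (hu.of_le one_le_two) hw)
  have hcu := hu.continuous
  have hcw := hw.continuous
  have hcz := hz.continuous
  have hcρ : Continuous fun x => (‖pderiv i u x‖ ^ 2 + ε) ^ (q / 2) :=
    hρ.continuous.rpow_const fun x => Or.inl (hpos x).ne'
  have hd : ∀ x, pderiv i (fun x => (‖pderiv i u x‖ ^ 2 + ε) ^ (q / 2) *
      inner ℝ (u x) (pderiv i u x)) x =
      (2 * inner ℝ (pderiv i u x) (pderiv i (pderiv i u) x)) * (q / 2) *
        (‖pderiv i u x‖ ^ 2 + ε) ^ (q / 2 - 1) * inner ℝ (u x) (pderiv i u x) +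
      (‖pderiv i u x‖ ^ 2 + ε) ^ (q / 2) *
        (inner ℝ (u x) (pderiv i (pderiv i u) x) + ‖pderiv i u x‖ ^ 2) := by
    intro x
    apply pderiv_eq_of_hasDerivAt
    have h1 := (hu.of_le one_le_two).hasDerivAt_zero i x
    have h2 := hw.hasDerivAt_zero i x
    have h3 := ((h2.norm_sq.add_const ε).rpow_const (p := q / 2)
      (Or.inl (by rw [shift_zero]; exact (hpos x).ne'))).mul (h1.inner ℝ h2)
    simpa only [shift_zero, real_inner_self_eq_norm_sq] using! h3
  have h0 := integral_pderiv hφ i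
  have hcd : Continuous (pderiv i (fun x => (‖pderiv i u x‖ ^ 2 + ε) ^ (q / 2) *
      inner ℝ (u x) (pderiv i u x))) := (IsSmooth.pderiv (n := 0) hφ i).continuous
  have hcl : Continuous fun x => (‖pderiv i u x‖ ^ 2 + ε) ^ (q / 2) * ‖pderiv i u x‖ ^ 2 :=
    hcρ.mul (hcw.norm.pow 2)
  rw [← sub_zero (∫ x, _ ∂(haar d)), ← h0, ← integral_sub
    (integrable_of_continuous hcl) (integrable_of_continuous hcd)]
  refine integral_mono (integrable_of_continuous (hcl.sub hcd))
    (integrable_of_continuous (continuous_const.mul ((hcu.norm.mul hcρ).mul hcz.norm))) fun x => ?_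
  simp only [hd]
  set w := pderiv i u x
  set z := pderiv i (pderiv i u) x
  have hρx := hpos x
  set ρ := ‖w‖ ^ 2 + ε
  have e1 : ρ ^ (q / 2 - 1) * ρ = ρ ^ (q / 2) := by
    rw [Real.rpow_sub_one hρx.ne', div_mul_cancel₀ _ hρx.ne']
  have n1 : 0 < ρ ^ (q / 2 - 1) := Real.rpow_pos_of_pos hρx _
  have n2 : 0 < ρ ^ (q / 2) := Real.rpow_pos_of_pos hρx _
  have b1 : -(inner ℝ w z * inner ℝ (u x) w) ≤ ‖u x‖ * ‖z‖ * ρ := by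
    have a1 := abs_real_inner_le_norm w z
    have a2 := abs_real_inner_le_norm (u x) w
    calc -(inner ℝ w z * inner ℝ (u x) w) ≤ |inner ℝ w z| * |inner ℝ (u x) w| := by
          rw [← abs_mul]; exact neg_le_abs _
      _ ≤ (‖w‖ * ‖z‖) * (‖u x‖ * ‖w‖) := by gcongr
      _ = ‖u x‖ * ‖z‖ * ‖w‖ ^ 2 := by ring
      _ ≤ ‖u x‖ * ‖z‖ * ρ := by
          gcongr
          simp only [ρ]
          linarith
  have b2 : -inner ℝ (u x) z ≤ ‖u x‖ * ‖z‖ :=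
    (neg_le_abs _).trans (abs_real_inner_le_norm _ _)
  have c1 := mul_le_mul_of_nonneg_left b1 (mul_nonneg hq.le n1.le)
  have c2 := mul_le_mul_of_nonneg_left b2 n2.le
  have e2 : q * ρ ^ (q / 2 - 1) * (‖u x‖ * ‖z‖ * ρ) = q * (‖u x‖ * ρ ^ (q / 2) * ‖z‖) := by
    rw [← e1]; ring
  rw [e2] at c1
  nlinarith

theorem integral_rpow_pderiv_le {u : Torus d → E} (hu : IsSmooth 2 u) (i : Fin d) {q : ℝ}
    (hq : 0 < q) :
    ∫ x, ‖pderiv i u x‖ ^ (q + 2) ∂(haar d) ≤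
      ∫ x, (q + 1) * (‖u x‖ * ‖pderiv i u x‖ ^ q * ‖pderiv i (pderiv i u) x‖) ∂(haar d) := by
  have hw : IsSmooth 1 (pderiv i u) := hu.pderiv i
  have hz : IsSmooth 0 (pderiv i (pderiv i u)) := hw.pderiv i
  have hcu := hu.continuous
  have hcw := hw.continuous
  have hcz := hz.continuous
  -- The absolute value makes the integrand continuous for all real ε, so both integrals are
  -- continuous at 0 and the limit ε → 0⁺ can be taken.
  have hρ : Continuous fun p : ℝ × Torus d => (‖pderiv i u p.2‖ ^ 2 + |p.1|) ^ (q / 2) :=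
    Continuous.rpow_const (by fun_prop) fun _ => Or.inr (by positivity)
  have hL := continuous_parametric_integral_of_continuous (μ := haar d)
    (f := fun (ε : ℝ) x => (‖pderiv i u x‖ ^ 2 + |ε|) ^ (q / 2) * ‖pderiv i u x‖ ^ 2)
    (hρ.mul (by fun_prop)) isCompact_univ
  have hR := continuous_parametric_integral_of_continuous (μ := haar d)
    (f := fun (ε : ℝ) x => (q + 1) *
      (‖u x‖ * (‖pderiv i u x‖ ^ 2 + |ε|) ^ (q / 2) * ‖pderiv i (pderiv i u) x‖))
    (continuous_const.mul
      ((Continuous.mul (by fun_prop) hρ).mul (by fun_prop))) isCompact_univ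
  simp only [Measure.restrict_univ] at hL hR
  have hlim := le_of_tendsto_of_tendsto (b := 𝓝[>] (0 : ℝ))
    (hL.continuousAt.tendsto.mono_left nhdsWithin_le_nhds)
    (hR.continuousAt.tendsto.mono_left nhdsWithin_le_nhds) ?_
  · have e : ∀ x, (‖pderiv i u x‖ ^ 2 + |(0 : ℝ)|) ^ (q / 2) = ‖pderiv i u x‖ ^ q := by
      intro x
      rw [abs_zero, add_zero, ← Real.rpow_natCast, ← Real.rpow_mul (norm_nonneg _)]
      congr 1
      push_cast
      ring
    have e2 : ∀ x, ‖pderiv i u x‖ ^ q * ‖pderiv i u x‖ ^ 2 = ‖pderiv i u x‖ ^ (q + 2) := by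
      intro x
      rw [Real.rpow_add_of_nonneg (norm_nonneg _) hq.le (by norm_num)]
      norm_num
    simpa only [e, e2] using hlim
  · filter_upwards [self_mem_nhdsWithin] with ε hε
    rw [abs_of_pos hε]
    exact integral_rpow_pderiv_le_of_pos hu i hq hε

theorem continuous_norm_rpow {X F : Type*} [TopologicalSpace X] [NormedAddCommGroup F]
    {f : X → F} (hf : Continuous f) {p : ℝ} (hp : 0 ≤ p) : Continuous fun x => ‖f x‖ ^ p :=
  hf.norm.rpow_const fun _ => Or.inr hp

/-- The basic interpolation step: Young splits off half of the left side, which is absorbed. The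
constant depends on p alone, in particular not on the target dimension. -/
theorem exists_integral_rpow_pderiv_le {p : ℝ} (hp : 2 < p) :
    ∃ K, 0 ≤ K ∧ ∀ {m : ℕ} {u : Torus d → RVec m}, IsSmooth 2 u → ∀ i,
      ∫ x, ‖pderiv i u x‖ ^ p ∂(haar d) ≤
        K * ∫ x, (‖u x‖ * ‖pderiv i (pderiv i u) x‖) ^ (p / 2) ∂(haar d) := by
  obtain ⟨q, hq, rfl⟩ : ∃ q, 0 < q ∧ p = q + 2 := ⟨p - 2, by linarith, by ring⟩
  refine ⟨2 * ((q + 1) * (2 * (q + 1)) ^ (q / 2)), by positivity, fun {m u} hu i => ?_⟩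
  have hcu := hu.continuous
  have hcw := (IsSmooth.pderiv (n := 1) hu i).continuous
  have hcz := (IsSmooth.pderiv (n := 0) (IsSmooth.pderiv (n := 1) hu i) i).continuous
  have h1 := integral_rpow_pderiv_le hu i hq
  have i1 : Integrable (fun x => 1 / 2 * ‖pderiv i u x‖ ^ (q + 2)) (haar d) :=
    integrable_of_continuous (continuous_const.mul (continuous_norm_rpow hcw (by linarith)))
  have i2 : Integrable (fun x => (q + 1) * (2 * (q + 1)) ^ (q / 2) *
      (‖u x‖ * ‖pderiv i (pderiv i u) x‖) ^ ((q + 2) / 2)) (haar d) :=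
    integrable_of_continuous (continuous_const.mul ((hcu.norm.mul hcz.norm).rpow_const
      fun _ => Or.inr (by linarith)))
  have h2 : ∫ x, (q + 1) * (‖u x‖ * ‖pderiv i u x‖ ^ q * ‖pderiv i (pderiv i u) x‖) ∂(haar d) ≤
      ∫ x, (1 / 2 * ‖pderiv i u x‖ ^ (q + 2) + (q + 1) * (2 * (q + 1)) ^ (q / 2) *
        (‖u x‖ * ‖pderiv i (pderiv i u) x‖) ^ ((q + 2) / 2)) ∂(haar d) := by
    refine integral_mono (integrable_of_continuous (continuous_const.mul
      ((hcu.norm.mul (continuous_norm_rpow hcw hq.le)).mul hcz.norm))) (i1.add i2) fun x => ?_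
    exact mul_rpow_mul_le (by linarith) (norm_nonneg _) (norm_nonneg _) (norm_nonneg _) hq
  have h3 := h1.trans h2
  rw [integral_add i1 i2, integral_const_mul, integral_const_mul] at h3
  linarith

theorem pderiv_sub_const {f : Torus d → E} (c : E) (i : Fin d) :
    pderiv i (fun x => f x - c) = pderiv i f := by
  funext x
  simp [pderiv]

/-- One rung of the Gagliardo–Nirenberg ladder. Interpolating the derivative of order j + 1 between
its two neighbours produces a term of order j, which the induction hypothesis sends back to order j
+ 1, where it is absorbed. At the bottom, the undifferentiated factor is f - c, bounded by A. -/
theorem exists_integral_iterate_pderiv_le_succ (d s : ℕ) (A : ℝ) (j : ℕ) (hj : 1 ≤ j) (hjs : j < s) :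
    ∃ C, 0 ≤ C ∧ ∀ {m : ℕ} {f : Torus d → RVec m} (c : RVec m), IsSmooth s f →
      (∀ x, ‖f x - c‖ ≤ A) → ∀ i,
      ∫ x, ‖(pderiv i)^[j] f x‖ ^ (2 * s / j : ℝ) ∂(haar d) ≤
        C * ∫ x, ‖(pderiv i)^[j + 1] f x‖ ^ (2 * s / ((j + 1 : ℕ)) : ℝ) ∂(haar d) := by
  induction j, hj using Nat.le_induction with
  | base =>
    have hs : (2 : ℝ) ≤ s := by exact_mod_cast hjs
    obtain ⟨K, hK, h⟩ := exists_integral_rpow_pderiv_le (d := d) (p := 2 * s) (by linarith)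
    refine ⟨K * |A| ^ (s : ℝ), by positivity, fun {m f} c hf hA i => ?_⟩
    have hf2 : IsSmooth 2 fun x => f x - c := ContDiff.sub (hf.of_le hjs) contDiff_const
    have h1 := h hf2 i
    rw [pderiv_sub_const] at h1
    have hcz : Continuous (pderiv i (pderiv i f)) :=
      (IsSmooth.pderiv (n := 0) (IsSmooth.pderiv (n := 1) (hf.of_le hjs) i) i).continuous
    have e1 : (2 * s / (1 : ℕ) : ℝ) = 2 * s := by simp
    have e2 : (2 * s / (1 + 1 : ℕ) : ℝ) = s := by push_cast; ring
    simp only [e1, e2, Function.iterate_succ_apply', Function.iterate_zero, id]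
    refine h1.trans ?_
    rw [mul_assoc, ← integral_const_mul (|A| ^ (s : ℝ))]
    refine mul_le_mul_of_nonneg_left (integral_mono (integrable_of_continuous ?_)
      (integrable_of_continuous (continuous_const.mul (continuous_norm_rpow hcz (by linarith))))
      fun x => ?_) hK
    · exact (hf2.continuous.norm.mul hcz.norm).rpow_const fun _ => Or.inr (by positivity)
    · simp only
      rw [show (2 * s / 2 : ℝ) = s by ring, ← Real.mul_rpow (abs_nonneg _) (norm_nonneg _)]
      gcongr
      exact (hA x).trans (le_abs_self A)
  | succ j hj ih =>
    obtain ⟨C, hC, ih⟩ := ih (by omega)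
    have hj' : (1 : ℝ) ≤ j := by exact_mod_cast hj
    have hs : (j : ℝ) + 1 < s := by exact_mod_cast hjs
    set p : ℝ := 2 * s / (j + 1 : ℕ) with hp
    have hp2 : 2 < p := by
      rw [hp, lt_div_iff₀ (by positivity)]
      push_cast
      linarith
    obtain ⟨K, hK, h⟩ := exists_integral_rpow_pderiv_le (d := d) hp2
    -- This weight matches the exponents: (2s/j)θ = (2s/(j+2))(1 - θ) = s/(j+1). The choice of δ
    -- below makes the returning term at most half of the left side.
    set θ : ℝ := j / (2 * (j + 1)) with hθ
    obtain ⟨L, hL, hY⟩ := exists_rpow_mul_rpow_le (θ := θ) (δ := 1 / (2 * (K * C + 1)))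
      (by positivity) (by rw [hθ, div_lt_one (by positivity)]; linarith) (by positivity)
    refine ⟨2 * (K * L), by positivity, fun {m f} c hf hA i => ?_⟩
    have sm : ∀ k ≤ s, Continuous ((pderiv i)^[k] f) := fun k hk =>
      (hf.iterate_pderiv hk i).continuous
    have hu : IsSmooth 2 ((pderiv i)^[j] f) :=
      (hf.iterate_pderiv (by omega : j ≤ s) i).of_le (by omega)
    have h1 := h hu i
    have h2 := ih c hf hA i
    simp only [← Function.iterate_succ_apply' (pderiv i)] at h1
    set I0 := ∫ x, ‖(pderiv i)^[j] f x‖ ^ (2 * s / j : ℝ) ∂(haar d)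
    set I1 := ∫ x, ‖(pderiv i)^[j + 1] f x‖ ^ p ∂(haar d)
    set I2 := ∫ x, ‖(pderiv i)^[j + 1 + 1] f x‖ ^ (2 * s / (j + 1 + 1 : ℕ) : ℝ) ∂(haar d)
    have h3 : ∫ x, (‖(pderiv i)^[j] f x‖ * ‖(pderiv i)^[j + 1 + 1] f x‖) ^ (p / 2) ∂(haar d) ≤
        1 / (2 * (K * C + 1)) * I0 + L * I2 := by
      have i0 : Integrable (fun x => 1 / (2 * (K * C + 1)) *
          ‖(pderiv i)^[j] f x‖ ^ (2 * s / j : ℝ)) (haar d) :=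
        integrable_of_continuous (continuous_const.mul
          (continuous_norm_rpow (sm j (by omega)) (by positivity)))
      have i2 : Integrable (fun x => L *
          ‖(pderiv i)^[j + 1 + 1] f x‖ ^ (2 * s / (j + 1 + 1 : ℕ) : ℝ)) (haar d) :=
        integrable_of_continuous (continuous_const.mul
          (continuous_norm_rpow (sm (j + 1 + 1) (by omega)) (by positivity)))
      rw [← integral_const_mul, ← integral_const_mul, ← integral_add i0 i2]
      refine integral_mono (integrable_of_continuous (((sm j (by omega)).norm.mul
        (sm (j + 1 + 1) (by omega)).norm).rpow_const fun _ => Or.inr (by positivity)))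
        (i0.add i2) fun x => ?_
      have h4 := hY (‖(pderiv i)^[j] f x‖ ^ (2 * s / j : ℝ))
        (‖(pderiv i)^[j + 1 + 1] f x‖ ^ (2 * s / (j + 1 + 1 : ℕ) : ℝ))
        (by positivity) (by positivity)
      rw [← Real.rpow_mul (norm_nonneg _), ← Real.rpow_mul (norm_nonneg _)] at h4
      have e1 : (2 * s / j : ℝ) * θ = p / 2 := by
        rw [hθ, hp]; push_cast; field_simp
      have e2 : (2 * s / (j + 1 + 1 : ℕ) : ℝ) * (1 - θ) = p / 2 := by
        rw [hθ, hp]; push_cast; field_simp; ring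
      rw [e1, e2, ← Real.mul_rpow (norm_nonneg _) (norm_nonneg _)] at h4
      exact h4
    have hI1 : 0 ≤ I1 := integral_nonneg fun x => by positivity
    have h5 : K * (1 / (2 * (K * C + 1)) * I0) ≤ 1 / 2 * I1 := by
      have hk : (0 : ℝ) < K * C + 1 := by positivity
      calc K * (1 / (2 * (K * C + 1)) * I0) ≤ K * (1 / (2 * (K * C + 1)) * (C * I1)) := by gcongr
        _ = (K * C) / (K * C + 1) * (1 / 2 * I1) := by field_simp
        _ ≤ 1 * (1 / 2 * I1) := by
            gcongr
            rw [div_le_one hk]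
            linarith
        _ = _ := one_mul _
    have h6 := h1.trans (mul_le_mul_of_nonneg_left h3 hK)
    rw [mul_add] at h6
    nlinarith

/-- **Gagliardo–Nirenberg inequality** for the pure partial derivatives of a `Cˢ` function on
the torus of bounded oscillation, with constants independent of the dimension of the target. -/
theorem exists_integral_iterate_pderiv_le (d s : ℕ) (A : ℝ) (j : ℕ) (hj : 1 ≤ j) (hjs : j ≤ s) :
    ∃ C, 0 ≤ C ∧ ∀ {m : ℕ} {f : Torus d → RVec m} (c : RVec m), IsSmooth s f →
      (∀ x, ‖f x - c‖ ≤ A) → ∀ i,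
      ∫ x, ‖(pderiv i)^[j] f x‖ ^ (2 * s / j : ℝ) ∂(haar d) ≤
        C * ∫ x, ‖(pderiv i)^[s] f x‖ ^ 2 ∂(haar d) := by
  induction hjs using Nat.decreasingInduction with
  | self =>
    refine ⟨1, zero_le_one, fun c hf hA i => le_of_eq ?_⟩
    have hs : (s : ℝ) ≠ 0 := by exact_mod_cast (by omega : s ≠ 0)
    simp [hs]
  | of_succ j hjs ih =>
    obtain ⟨C, hC, h⟩ := exists_integral_iterate_pderiv_le_succ d s A j hj hjs
    obtain ⟨C', hC', h'⟩ := ih (by omega)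
    refine ⟨C * C', by positivity, fun c hf hA i => ?_⟩
    rw [mul_assoc]
    exact (h c hf hA i).trans (mul_le_mul_of_nonneg_left (h' c hf hA i) hC)

end GagliardoNirenberg

/-! ### Composition with functions of bounded derivatives -/

section Composition

variable {d : ℕ}

/-- The Faà di Bruno bound s! B Dˢ holds whenever the j-th derivative of the inner function is at
most Dʲ. The exponents 2s/j are those for which D = S^{1/(2s)} is admissible, and then (Dˢ)² = S. -/
theorem norm_iterate_pderiv_comp_sq_le {s m : ℕ} (hs : 1 ≤ s) {B : ℝ} (hB : 0 ≤ B)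
    {σ : RVec m → RVec m} (hσ : BoundedDerivatives s B σ) {f : Torus d → RVec m}
    (hf : IsSmooth s f) (i : Fin d) (x : Torus d) :
    ‖(pderiv i)^[s] (fun x => σ (f x)) x‖ ^ 2 ≤
      (s ! * B) ^ 2 * ∑ j ∈ Finset.Icc 1 s, ‖(pderiv i)^[j] f x‖ ^ (2 * s / j : ℝ) := by
  set S := ∑ j ∈ Finset.Icc 1 s, ‖(pderiv i)^[j] f x‖ ^ (2 * s / j : ℝ) with hS
  have hs0 : (0 : ℝ) < s := by exact_mod_cast hs
  have hS0 : 0 ≤ S := Finset.sum_nonneg fun j _ => by positivity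
  set D : ℝ := S ^ (1 / (2 * s) : ℝ) with hD
  have hD0 : 0 ≤ D := Real.rpow_nonneg hS0 _
  have hDj : ∀ j, 1 ≤ j → j ≤ s → ‖(pderiv i)^[j] f x‖ ≤ D ^ j := by
    intro j h1 h2
    have hj0 : (0 : ℝ) < j := by exact_mod_cast h1
    have h3 : ‖(pderiv i)^[j] f x‖ ^ (2 * s / j : ℝ) ≤ S :=
      Finset.single_le_sum (f := fun j : ℕ => ‖(pderiv i)^[j] f x‖ ^ (2 * s / j : ℝ))
        (fun j _ => by positivity) (Finset.mem_Icc.2 ⟨h1, h2⟩)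
    have h4 := Real.rpow_le_rpow (by positivity) h3 (z := (j / (2 * s) : ℝ)) (by positivity)
    rw [← Real.rpow_mul (norm_nonneg _), show (2 * s / j : ℝ) * (j / (2 * s)) = 1 by field_simp,
      Real.rpow_one] at h4
    refine h4.trans (le_of_eq ?_)
    rw [hD, ← Real.rpow_natCast, ← Real.rpow_mul hS0]
    congr 1
    field_simp
  have hDs : (D ^ s) ^ 2 = S := by
    rw [hD, ← pow_mul, ← Real.rpow_natCast, ← Real.rpow_mul hS0]
    push_cast
    rw [show (1 / (2 * s) * (s * 2) : ℝ) = 1 by field_simp, Real.rpow_one]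
  set g : ℝ → RVec m := fun τ => f (shift i x τ) with hg
  have hgc : ContDiff ℝ s g := hf.contDiff_line i x
  set y := f x
  have hy : g 0 = y := by simp [hg, y]
  -- The chain rule estimate also asks for a bound of order zero on the outer function at y.
  -- Subtracting σ(y) makes that value zero and changes no derivative of positive order.
  have hcomp : ContDiff ℝ s fun v => σ v - σ y := hσ.1.sub contDiff_const
  have hkey := norm_iteratedFDeriv_comp_le (𝕜 := ℝ) hcomp hgc (le_refl (s : ℕ∞ω)) 0 (C := B)
    (D := D) ?_ ?_
  · rw [norm_iteratedFDeriv_eq_norm_iteratedDeriv] at hkey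
    have hsm : IsSmooth s fun x => σ (f x) - σ y := IsSmooth.comp (g := fun v => σ v - σ y) hcomp hf
    have e1 := congrFun (hsm.iteratedDeriv_line i x) 0
    have e2 : (pderiv i)^[s] (fun x => σ (f x) - σ y) = (pderiv i)^[s] (fun x => σ (f x)) := by
      obtain ⟨r, rfl⟩ : ∃ r, s = r + 1 := ⟨s - 1, by omega⟩
      rw [Function.iterate_succ_apply, Function.iterate_succ_apply, pderiv_sub_const]
    rw [e2] at e1
    simp only [shift_zero] at e1
    rw [← e1]
    have h5 := pow_le_pow_left₀ (norm_nonneg _) hkey 2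
    rw [mul_pow, hDs] at h5
    exact h5
  · intro j hj
    rw [hy]
    rcases Nat.eq_zero_or_pos j with rfl | hj0
    · simpa using hB
    · have e : iteratedFDeriv ℝ j (fun v => σ v - σ y) y = iteratedFDeriv ℝ j σ y := by
        have := iteratedFDeriv_sub_apply (𝕜 := ℝ) (x := y) (i := j) (f := σ) (g := fun _ => σ y)
          (hσ.1.contDiffAt.of_le (by exact_mod_cast hj)) contDiffAt_const
        rw [iteratedFDeriv_const_of_ne hj0.ne'] at this
        simpa using! this
      rw [e]
      exact hσ.2 j hj0 hj y
  · intro j h1 h2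
    rw [norm_iteratedFDeriv_eq_norm_iteratedDeriv, (hf.of_le h2).iteratedDeriv_line i x]
    simpa using hDj j h1 h2

theorem BoundedDerivatives.norm_sub_le {s m : ℕ} (hs : 1 ≤ s) {B : ℝ} {σ : RVec m → RVec m}
    (hσ : BoundedDerivatives s B σ) (u v : RVec m) : ‖σ u - σ v‖ ≤ B * ‖u - v‖ := by
  have hd : Differentiable ℝ σ := hσ.1.differentiable (by exact_mod_cast (by omega : s ≠ 0))
  refine Convex.norm_image_sub_le_of_norm_fderiv_le (𝕜 := ℝ) (s := Set.univ) (fun x _ => hd x)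
    (fun x _ => ?_) convex_univ (Set.mem_univ _) (Set.mem_univ _)
  rw [← norm_iteratedFDeriv_one]
  exact hσ.2 1 le_rfl hs x

theorem integrable_norm_sq {E : Type*} [NormedAddCommGroup E] {f : Torus d → E}
    (hf : Continuous f) : Integrable (fun x => ‖f x‖ ^ 2) (haar d) :=
  integrable_of_continuous (hf.norm.pow 2)

/-- `f` is of class `Cˢ`, deviates from a constant by at most `A`, and its pure partial derivatives
of order `s` have squared `L²` norm at most `R`. -/
structure SobolevBound {E : Type*} [NormedAddCommGroup E] [NormedSpace ℝ E] (s : ℕ) (A R : ℝ)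
    (f : Torus d → E) : Prop where
  smooth : IsSmooth s f
  osc : ∃ c, ∀ x, ‖f x - c‖ ≤ A
  integral_le : ∀ i, ∫ x, ‖(pderiv i)^[s] f x‖ ^ 2 ∂(haar d) ≤ R

theorem IsSmooth.continuous_iterate {E : Type*} [NormedAddCommGroup E] [NormedSpace ℝ E] {n j : ℕ}
    {f : Torus d → E} (h : IsSmooth n f) (hj : j ≤ n) (i : Fin d) :
    Continuous ((FNO.pderiv i)^[j] f) := (h.iterate_pderiv hj i).continuous

/-- Integrating the pointwise Faà di Bruno bound gives the L^{2s/j} norms that Gagliardo–Nirenberg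
controls; the oscillation bound follows from σ being B-Lipschitz. The new constants are chosen
before m, σ and f, hence are uniform over widths. -/
theorem exists_sobolevBound_comp (d : ℕ) {s : ℕ} (hs : 1 ≤ s) {B : ℝ} (hB : 0 ≤ B) (A R : ℝ) :
    ∃ A' R', ∀ {m : ℕ} {σ : RVec m → RVec m} {f : Torus d → RVec m},
      BoundedDerivatives s B σ → SobolevBound s A R f →
        SobolevBound s A' R' fun x => σ (f x) := by
  have hGN := fun j : {j // j ∈ Finset.Icc 1 s} => exists_integral_iterate_pderiv_le d s A j.1
    (Finset.mem_Icc.1 j.2).1 (Finset.mem_Icc.1 j.2).2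
  choose C hC h using hGN
  refine ⟨B * A, (s ! * B) ^ 2 * ∑ j, C j * R, fun {m σ f} hσ hf => ⟨hf.smooth.comp hσ.1, ?_, ?_⟩⟩
  · obtain ⟨c, hc⟩ := hf.osc
    exact ⟨σ c, fun x => (hσ.norm_sub_le hs _ _).trans (mul_le_mul_of_nonneg_left (hc x) hB)⟩
  · intro i
    obtain ⟨c, hc⟩ := hf.osc
    have hcont : ∀ j ∈ Finset.Icc 1 s,
        Continuous fun x => ‖(pderiv i)^[j] f x‖ ^ (2 * s / j : ℝ) := fun j hj =>
      continuous_norm_rpow (hf.smooth.continuous_iterate (Finset.mem_Icc.1 hj).2 i) (by positivity)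
    have hsum : Continuous fun x => (s ! * B) ^ 2 *
        ∑ j ∈ Finset.Icc 1 s, ‖(pderiv i)^[j] f x‖ ^ (2 * s / j : ℝ) :=
      continuous_const.mul (continuous_finsetSum _ hcont)
    have h1 := integral_mono
      (integrable_norm_sq ((hf.smooth.comp hσ.1).continuous_iterate le_rfl i))
      (integrable_of_continuous hsum)
      (norm_iterate_pderiv_comp_sq_le hs hB hσ hf.smooth i)
    refine h1.trans ?_
    rw [integral_const_mul, integral_finsetSum _ fun j hj => integrable_of_continuous (hcont j hj)]
    refine mul_le_mul_of_nonneg_left ?_ (by positivity)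
    rw [← Finset.sum_coe_sort]
    refine Finset.sum_le_sum fun j _ => (h j c hf.smooth hc i).trans ?_
    exact mul_le_mul_of_nonneg_left (hf.integral_le i) (hC j)

variable {E G : Type*} [NormedAddCommGroup E] [NormedSpace ℝ E] [NormedAddCommGroup G]
  [NormedSpace ℝ G] {s : ℕ} {A R A' R' M : ℝ}

theorem SobolevBound.add {f g : Torus d → E} (hf : SobolevBound s A R f)
    (hg : SobolevBound s A' R' g) :
    SobolevBound s (A + A') (2 * R + 2 * R') fun x => f x + g x := by
  refine ⟨hf.smooth.add hg.smooth, ?_, fun i => ?_⟩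
  · obtain ⟨c, hc⟩ := hf.osc
    obtain ⟨c', hc'⟩ := hg.osc
    refine ⟨c + c', fun x => ?_⟩
    rw [add_sub_add_comm]
    exact norm_add_le_of_le (hc x) (hc' x)
  · have hcf := hf.smooth.continuous_iterate le_rfl i
    have hcg := hg.smooth.continuous_iterate le_rfl i
    have i1 := integrable_norm_sq hcf
    have i2 := integrable_norm_sq hcg
    rw [iterate_pderiv_add hf.smooth hg.smooth]
    have h1 : ∫ x, ‖(pderiv i)^[s] f x + (pderiv i)^[s] g x‖ ^ 2 ∂(haar d) ≤
        ∫ x, (2 * ‖(pderiv i)^[s] f x‖ ^ 2 + 2 * ‖(pderiv i)^[s] g x‖ ^ 2) ∂(haar d) := by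
      refine integral_mono (integrable_norm_sq (hcf.add hcg))
        ((i1.const_mul 2).add (i2.const_mul 2)) fun x => ?_
      have := norm_add_le ((pderiv i)^[s] f x) ((pderiv i)^[s] g x)
      have h2 := pow_le_pow_left₀ (norm_nonneg _) this 2
      simp only
      nlinarith [sq_nonneg (‖(pderiv i)^[s] f x‖ - ‖(pderiv i)^[s] g x‖)]
    rw [integral_add (i1.const_mul 2) (i2.const_mul 2), integral_const_mul,
      integral_const_mul] at h1
    have hl := hf.integral_le i
    have hr := hg.integral_le i
    exact h1.trans (by linarith)

theorem SobolevBound.const (hs : 1 ≤ s) (c : E) :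
    SobolevBound s 0 0 fun _ : Torus d => c := by
  refine ⟨IsSmooth.const s c, ⟨c, fun x => by simp⟩, fun i => ?_⟩
  obtain ⟨r, rfl⟩ : ∃ r, s = r + 1 := ⟨s - 1, by omega⟩
  simp [iterate_pderiv_const r c i]

theorem SobolevBound.clm {f : Torus d → E} (hf : SobolevBound s A R f) (L : E →L[ℝ] G)
    (hL : ‖L‖ ≤ M) : SobolevBound s (M * A) (M ^ 2 * R) fun x => L (f x) := by
  have hM : 0 ≤ M := (norm_nonneg L).trans hL
  refine ⟨hf.smooth.comp L.contDiff, ?_, fun i => ?_⟩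
  · obtain ⟨c, hc⟩ := hf.osc
    refine ⟨L c, fun x => ?_⟩
    rw [← map_sub]
    exact (L.le_of_opNorm_le hL _).trans (mul_le_mul_of_nonneg_left (hc x) hM)
  · have hcf := hf.smooth.continuous_iterate le_rfl i
    rw [iterate_pderiv_clm L hf.smooth]
    refine le_trans ?_ (mul_le_mul_of_nonneg_left (hf.integral_le i) (sq_nonneg M))
    rw [← integral_const_mul]
    refine integral_mono (integrable_norm_sq (L.continuous.comp hcf))
      (integrable_of_continuous (continuous_const.mul (hcf.norm.pow 2))) fun x => ?_
    simp only [← mul_pow]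
    exact pow_le_pow_left₀ (norm_nonneg _) (L.le_of_opNorm_le hL _) 2

end Composition

/-! ### Trigonometric polynomials and Fourier coefficients -/

section Fourier

open UnitAddTorus

variable {d m : ℕ}

/-- The squared Euclidean norm of a frequency. -/
def freqSq (k : Fin d → ℤ) : ℝ := ∑ i, (k i : ℝ) ^ 2

theorem freqSq_nonneg (k : Fin d → ℤ) : 0 ≤ freqSq k := Finset.sum_nonneg fun _ _ => sq_nonneg _

theorem freqSq_pos {k : Fin d → ℤ} (hk : k ≠ 0) : 0 < freqSq k := by
  obtain ⟨i, hi⟩ := Function.ne_iff.1 hk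
  refine Finset.sum_pos' (fun _ _ => sq_nonneg _) ⟨i, Finset.mem_univ i, ?_⟩
  have : (k i : ℝ) ≠ 0 := by exact_mod_cast hi
  positivity

/-- The power mean inequality. Because of it, pure partial derivatives suffice to control the energy
and mixed ones never appear. -/
theorem freqSq_pow_le {s : ℕ} (hs : 1 ≤ s) (k : Fin d → ℤ) :
    freqSq k ^ s ≤ (d : ℝ) ^ (s - 1) * ∑ i, (k i : ℝ) ^ (2 * s) := by
  obtain ⟨r, rfl⟩ : ∃ r, s = r + 1 := ⟨s - 1, by omega⟩
  rcases Nat.eq_zero_or_pos d with rfl | hd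
  · simp [freqSq]
  have h := pow_sum_div_card_le_sum_pow (s := Finset.univ) (f := fun i => (k i : ℝ) ^ 2)
    (fun _ _ => sq_nonneg _) r
  rw [div_le_iff₀' (by simpa using pow_pos (by exact_mod_cast hd) r)] at h
  simpa [freqSq, pow_mul] using h

/-- Entrywise real part as a real-linear map. -/
def rePartL (m : ℕ) : CVec m →L[ℝ] RVec m :=
  LinearMap.mkContinuous
    { toFun := rePart
      map_add' := fun _ _ => by ext; simp [rePart]
      map_smul' := fun _ _ => by ext; simp [rePart] } 1 fun w => by
    rw [one_mul]
    simp only [LinearMap.coe_mk, AddHom.coe_mk, EuclideanSpace.norm_eq, rePart]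
    gcongr
    exact Complex.abs_re_le_norm _

@[simp] theorem rePartL_apply (w : CVec m) : rePartL m w = rePart w := rfl

theorem norm_rePartL_le : ‖rePartL m‖ ≤ 1 := LinearMap.mkContinuous_norm_le _ zero_le_one _

/-- The inclusion of real into complex vectors as a real-linear map. -/
def toCL (m : ℕ) : RVec m →L[ℝ] CVec m :=
  LinearMap.mkContinuous
    { toFun := toC
      map_add' := fun _ _ => by ext; simp [toC]
      map_smul' := fun _ _ => by ext; simp [toC] } 1 fun w => by
    rw [one_mul]
    simp [EuclideanSpace.norm_eq, toC]

@[simp] theorem toCL_apply (v : RVec m) : toCL m v = toC v := rfl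

theorem norm_toC (v : RVec m) : ‖toC v‖ = ‖v‖ := by simp [EuclideanSpace.norm_eq, toC]

theorem norm_toCL_le : ‖toCL m‖ ≤ 1 := LinearMap.mkContinuous_norm_le _ zero_le_one _

theorem rePart_toC (v : RVec m) : rePart (toC v) = v := by ext; simp [rePart, toC]

theorem norm_mFourier_apply (k : Fin d → ℤ) (x : Torus d) : ‖mFourier k x‖ = 1 := by
  simp only [mFourier, ContinuousMap.coe_mk, norm_prod, fourier_apply, Circle.norm_coe,
    Finset.prod_const_one]

theorem mFourier_shift (k : Fin d → ℤ) (i : Fin d) (x : Torus d) (τ : ℝ) :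
    mFourier k (shift i x τ) = Complex.exp (2 * Real.pi * Complex.I * k i * τ) * mFourier k x := by
  simp only [mFourier, ContinuousMap.coe_mk, shift, Pi.add_apply, fourier_apply, smul_add,
    AddCircle.toCircle_add, Circle.coe_mul, Finset.prod_mul_distrib]
  rw [mul_comm]
  congr 1
  rw [Finset.prod_eq_single i]
  · rw [Pi.single_eq_same, ← fourier_apply, fourier_coe_apply]
    simp
  · intro j _ hj
    simp [Pi.single_eq_of_ne hj]
  · simp

theorem hasDerivAt_mFourier_shift (k : Fin d → ℤ) (i : Fin d) (x : Torus d) :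
    HasDerivAt (fun τ => mFourier k (shift i x τ))
      (2 * Real.pi * Complex.I * k i * mFourier k x) 0 := by
  simp only [mFourier_shift]
  have h1 : HasDerivAt (fun τ : ℝ => 2 * Real.pi * Complex.I * k i * (τ : ℂ))
      (2 * Real.pi * Complex.I * k i) 0 := by
    simpa using (Complex.ofRealCLM.hasDerivAt (x := (0 : ℝ))).const_mul
      (2 * Real.pi * Complex.I * k i)
  simpa using h1.cexp.mul_const (mFourier k x)

theorem isSmooth_mFourier (n : ℕ) (k : Fin d → ℤ) : IsSmooth n (mFourier k : Torus d → ℂ) := by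
  unfold IsSmooth
  simp only [mFourier, ContinuousMap.coe_mk, mk, fourier_coe_apply]
  refine contDiff_prod fun i _ => ?_
  refine Complex.contDiff_exp.comp ((contDiff_const.mul ?_).div_const _)
  exact Complex.ofRealCLM.contDiff.comp (contDiff_apply ℝ ℝ i)

/-- The trigonometric polynomial with coefficients `c` on the frequencies in `S`. -/
def trigPoly (S : Finset (Fin d → ℤ)) (c : (Fin d → ℤ) → CVec m) (x : Torus d) : CVec m :=
  ∑ k ∈ S, mFourier k x • c k

theorem isSmooth_trigPoly (n : ℕ) (S : Finset (Fin d → ℤ)) (c : (Fin d → ℤ) → CVec m) :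
    IsSmooth n (trigPoly S c) := by
  unfold IsSmooth trigPoly
  exact ContDiff.sum fun k _ => ContDiff.smul (isSmooth_mFourier n k) contDiff_const

theorem continuous_trigPoly (S : Finset (Fin d → ℤ)) (c : (Fin d → ℤ) → CVec m) :
    Continuous (trigPoly S c) := (isSmooth_trigPoly 0 S c).continuous

theorem pderiv_trigPoly (S : Finset (Fin d → ℤ)) (c : (Fin d → ℤ) → CVec m) (i : Fin d) :
    pderiv i (trigPoly S c) = trigPoly S fun k => (2 * Real.pi * Complex.I * k i : ℂ) • c k := by
  funext x
  apply pderiv_eq_of_hasDerivAt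
  unfold trigPoly
  refine HasDerivAt.fun_sum fun k _ => ?_
  have h := (hasDerivAt_mFourier_shift k i x).smul_const (c k)
  rw [smul_smul, mul_comm (mFourier k x)]
  exact h

theorem iterate_pderiv_trigPoly (S : Finset (Fin d → ℤ)) (c : (Fin d → ℤ) → CVec m) (i : Fin d)
    (n : ℕ) : (pderiv i)^[n] (trigPoly S c) =
      trigPoly S fun k => (2 * Real.pi * Complex.I * k i : ℂ) ^ n • c k := by
  induction n with
  | zero => simp
  | succ n ih =>
    rw [Function.iterate_succ_apply', ih, pderiv_trigPoly]
    simp only [smul_smul, pow_succ']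

/-- The Fourier coefficient of a complex vector-valued function. -/
def coeff (f : Torus d → CVec m) (k : Fin d → ℤ) : CVec m := ∫ x, mFourier (-k) x • f x ∂(haar d)

theorem integral_mFourier (k : Fin d → ℤ) :
    ∫ x, mFourier k x ∂(haar d) = if k = 0 then 1 else 0 := by
  split_ifs with h
  · subst h
    simp [mFourier_zero]
  · obtain ⟨i, hi⟩ := Function.ne_iff.1 h
    have h1 := integral_pderiv (isSmooth_mFourier 1 k) i
    have h2 : pderiv i (mFourier k : Torus d → ℂ) =
        fun x => 2 * Real.pi * Complex.I * k i * mFourier k x :=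
      funext fun x => pderiv_eq_of_hasDerivAt (hasDerivAt_mFourier_shift k i x)
    rw [h2, integral_const_mul, mul_eq_zero] at h1
    refine h1.resolve_left ?_
    have : (k i : ℂ) ≠ 0 := by exact_mod_cast hi
    have hpi : (Real.pi : ℂ) ≠ 0 := by exact_mod_cast Real.pi_ne_zero
    simp [this, hpi]

theorem coeff_trigPoly (S : Finset (Fin d → ℤ)) (c : (Fin d → ℤ) → CVec m) {k : Fin d → ℤ}
    (hk : k ∈ S) : coeff (trigPoly S c) k = c k := by
  unfold coeff trigPoly
  simp only [Finset.smul_sum, smul_smul, ← mFourier_add]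
  rw [integral_finsetSum _ fun l _ => integrable_of_continuous (by fun_prop)]
  simp only [integral_smul_const, integral_mFourier]
  rw [Finset.sum_eq_single k]
  · simp
  · intro l _ hl
    rw [if_neg, zero_smul]
    intro h
    exact hl (neg_add_eq_zero.1 h).symm
  · exact fun h => absurd hk h

theorem integral_inner_trigPoly (S : Finset (Fin d → ℤ)) (c : (Fin d → ℤ) → CVec m)
    {f : Torus d → CVec m} (hf : Continuous f) :
    ∫ x, inner ℂ (trigPoly S c x) (f x) ∂(haar d) = ∑ k ∈ S, inner ℂ (c k) (coeff f k) := by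
  have h : ∀ x, inner ℂ (trigPoly S c x) (f x) =
      ∑ k ∈ S, inner ℂ (c k) (mFourier (-k) x • f x) := by
    intro x
    simp only [trigPoly, sum_inner, inner_smul_left, inner_smul_right, mFourier_neg]
  have hi : ∀ k, Integrable (fun x => mFourier (-k) x • f x) (haar d) := fun k =>
    integrable_of_continuous ((mFourier (-k)).continuous.smul hf)
  simp only [h]
  rw [integral_finsetSum _ fun k _ => (hi k).const_inner (c k)]
  exact Finset.sum_congr rfl fun k _ => integral_inner (hi k) (c k)

theorem integral_norm_trigPoly_sq (S : Finset (Fin d → ℤ)) (c : (Fin d → ℤ) → CVec m) :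
    ∫ x, ‖trigPoly S c x‖ ^ 2 ∂(haar d) = ∑ k ∈ S, ‖c k‖ ^ 2 := by
  have h := integral_inner_trigPoly S c (continuous_trigPoly S c)
  rw [Finset.sum_congr rfl fun k hk => by rw [coeff_trigPoly S c hk]] at h
  simp only [inner_self_eq_norm_sq_to_K] at h
  have h2 : ((∫ x, ‖trigPoly S c x‖ ^ 2 ∂(haar d) : ℝ) : ℂ) =
      ((∑ k ∈ S, ‖c k‖ ^ 2 : ℝ) : ℂ) := by
    rw [← integral_complex_ofReal]
    push_cast
    exact h
  exact_mod_cast h2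

/-- **Bessel's inequality** for continuous vector-valued functions on the torus. -/
theorem sum_norm_coeff_sq_le (S : Finset (Fin d → ℤ)) {f : Torus d → CVec m} (hf : Continuous f) :
    ∑ k ∈ S, ‖coeff f k‖ ^ 2 ≤ ∫ x, ‖f x‖ ^ 2 ∂(haar d) := by
  set g := trigPoly S (coeff f) with hg
  have hgc : Continuous g := continuous_trigPoly S _
  have h1 := integral_inner_trigPoly S (coeff f) hf
  have h2 : ∫ x, RCLike.re (inner ℂ (g x) (f x)) ∂(haar d) = ∑ k ∈ S, ‖coeff f k‖ ^ 2 := by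
    rw [integral_re (integrable_of_continuous (hgc.inner hf)), h1, map_sum]
    exact Finset.sum_congr rfl fun k _ => inner_self_eq_norm_sq _
  have h3 := integral_norm_trigPoly_sq S (coeff f)
  have hre : Continuous fun x => RCLike.re (inner ℂ (g x) (f x)) :=
    RCLike.continuous_re.comp (hgc.inner hf)
  have h4 : 0 ≤ ∫ x, ‖g x - f x‖ ^ 2 ∂(haar d) := integral_nonneg fun x => by positivity
  have i1 := integrable_norm_sq hf
  have i2 := integrable_norm_sq hgc
  have i3 := (integrable_of_continuous hre).const_mul 2
  simp only [@norm_sub_sq ℂ] at h4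
  have i4 : Integrable (fun x => ‖g x‖ ^ 2 - 2 * RCLike.re (inner ℂ (g x) (f x))) (haar d) :=
    i2.sub i3
  rw [integral_add i4 i1, integral_sub i2 i3, integral_const_mul, h2, h3] at h4
  linarith

/-- Integration by parts: the derivative of the conjugate character times f has integral zero. -/
theorem coeff_pderiv {f : Torus d → CVec m} (hf : IsSmooth 1 f) (i : Fin d) (k : Fin d → ℤ) :
    coeff (pderiv i f) k = (2 * Real.pi * Complex.I * k i : ℂ) • coeff f k := by
  have hs : IsSmooth 1 fun x => mFourier (-k) x • f x :=
    ContDiff.smul (isSmooth_mFourier 1 (-k)) hf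
  have h0 := integral_pderiv hs i
  have hd : pderiv i (fun x => mFourier (-k) x • f x) = fun x =>
      mFourier (-k) x • pderiv i f x -
        (2 * Real.pi * Complex.I * k i : ℂ) • (mFourier (-k) x • f x) := by
    funext x
    apply pderiv_eq_of_hasDerivAt
    have h := (hasDerivAt_mFourier_shift (-k) i x).smul (hf.hasDerivAt_zero i x)
    simp only [shift_zero] at h
    convert! h using 1
    rw [smul_smul, sub_eq_add_neg, ← neg_smul]
    congr 2
    push_cast [Pi.neg_apply]
    ring
  have i1 : Integrable (fun x => mFourier (-k) x • pderiv i f x) (haar d) :=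
    integrable_of_continuous ((mFourier (-k)).continuous.smul
      (IsSmooth.pderiv (n := 0) hf i).continuous)
  have i2 : Integrable (fun x => (2 * Real.pi * Complex.I * k i : ℂ) • (mFourier (-k) x • f x))
      (haar d) :=
    (integrable_of_continuous hs.continuous).smul (2 * Real.pi * Complex.I * k i : ℂ)
  rw [hd, integral_sub i1 i2, integral_smul, sub_eq_zero] at h0
  exact h0

theorem coeff_iterate_pderiv {n : ℕ} {f : Torus d → CVec m} (hf : IsSmooth n f) (i : Fin d)
    (k : Fin d → ℤ) :
    coeff ((pderiv i)^[n] f) k = (2 * Real.pi * Complex.I * k i : ℂ) ^ n • coeff f k := by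
  induction n generalizing f with
  | zero => simp
  | succ n ih =>
    rw [Function.iterate_succ_apply, ih (hf.pderiv i), coeff_pderiv (hf.of_le (by omega)),
      smul_smul, pow_succ]

theorem fourierCoeff_eq_coeff {v : Torus d → RVec m} (hv : Continuous v) (k : Fin d → ℤ) :
    fourierCoeff v k = coeff (fun x => toC (v x)) k := by
  ext j
  have hi : Integrable (fun x => mFourier (-k) x • toC (v x)) (haar d) :=
    integrable_of_continuous ((mFourier (-k)).continuous.smul ((toCL m).continuous.comp hv))
  exact (EuclideanSpace.proj (𝕜 := ℂ) j).integral_comp_comm hi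

end Fourier

/-! ### Decay of Fourier coefficients and convergence of Fourier series -/

section Decay

open UnitAddTorus

variable {d m s : ℕ}

/-- Inverse norm powers over a lattice are summable when the exponent, here 2s, exceeds the rank d.
The lattice sum uses the supremum norm, which is at most the Euclidean one. -/
theorem exists_sum_inv_freqSq_le (hs : (d : ℝ) / 2 < s) :
    ∃ Z, 0 ≤ Z ∧ ∀ S : Finset (Fin d → ℤ), ∑ k ∈ S, (freqSq k ^ s)⁻¹ ≤ Z := by
  have hds : d < 2 * s := by
    have : (d : ℝ) < 2 * s := by linarith
    exact_mod_cast this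
  let L : Submodule ℤ (Fin d → ℝ) := Submodule.span ℤ (Set.range (Pi.basisFun ℝ (Fin d)))
  have hr : Module.finrank ℤ L < 2 * s := by
    rw [ZLattice.rank ℝ L]
    simpa using hds
  have hL := ZLattice.summable_norm_pow_inv L (2 * s) hr
  have hmem : ∀ k : Fin d → ℤ, (fun i => (k i : ℝ)) ∈ L := by
    intro k
    rw [(Pi.basisFun ℝ (Fin d)).mem_span_iff_repr_mem ℤ]
    intro i
    simp
  let e : (Fin d → ℤ) → L := fun k => ⟨fun i => (k i : ℝ), hmem k⟩
  have he : Function.Injective e := by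
    intro k l h
    funext i
    have : ((k i : ℤ) : ℝ) = (l i : ℝ) := congrFun (congrArg Subtype.val h) i
    exact_mod_cast this
  have hsum := hL.comp_injective he
  have hle : ∀ k : Fin d → ℤ, (freqSq k ^ s)⁻¹ ≤ ‖e k‖⁻¹ ^ (2 * s) := by
    intro k
    rcases eq_or_ne k 0 with rfl | hk
    -- At frequency zero the summand is the inverse of 0, which is 0 by convention.
    · have : s ≠ 0 := by omega
      have h0 : freqSq (0 : Fin d → ℤ) = 0 := by simp [freqSq]
      rw [h0, zero_pow this, inv_zero]
      positivity
    · have hn : ‖e k‖ ^ 2 ≤ freqSq k := by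
        have h1 : ‖(fun i => (k i : ℝ) : Fin d → ℝ)‖ ≤ Real.sqrt (freqSq k) := by
          refine (pi_norm_le_iff_of_nonneg (Real.sqrt_nonneg _)).2 fun i => ?_
          refine Real.abs_le_sqrt ?_
          exact Finset.single_le_sum (f := fun i => (k i : ℝ) ^ 2)
            (fun _ _ => sq_nonneg _) (Finset.mem_univ i)
        calc ‖e k‖ ^ 2 ≤ Real.sqrt (freqSq k) ^ 2 := pow_le_pow_left₀ (norm_nonneg _) h1 2
          _ = freqSq k := Real.sq_sqrt (freqSq_nonneg k)
      have hpos : 0 < ‖e k‖ := by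
        rw [norm_pos_iff]
        intro h
        exact hk (he (h.trans (by ext; simp [e])))
      rw [inv_pow, pow_mul]
      gcongr
  refine ⟨∑' k, ‖e k‖⁻¹ ^ (2 * s), tsum_nonneg fun k => by positivity, fun S => ?_⟩
  exact (Finset.sum_le_sum fun k _ => hle k).trans
    (hsum.sum_le_tsum S fun k _ => pow_nonneg (inv_nonneg.2 (norm_nonneg _)) _)

/-- The homogeneous Sobolev energy of coefficients on a finite set of frequencies. -/
def energy (s : ℕ) (S : Finset (Fin d → ℤ)) (c : (Fin d → ℤ) → CVec m) : ℝ :=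
  ∑ k ∈ S, freqSq k ^ s * ‖c k‖ ^ 2

theorem energy_mono {S S' : Finset (Fin d → ℤ)} (h : S ⊆ S') (c : (Fin d → ℤ) → CVec m) :
    energy s S c ≤ energy s S' c :=
  Finset.sum_le_sum_of_subset_of_nonneg h fun k _ _ =>
    mul_nonneg (pow_nonneg (freqSq_nonneg k) s) (sq_nonneg _)

/-- Weighted Cauchy–Schwarz. Frequency zero must be excluded because the homogeneous energy does not
see it. -/
theorem sq_sum_norm_le {S : Finset (Fin d → ℤ)} (hS : (0 : Fin d → ℤ) ∉ S)
    (c : (Fin d → ℤ) → CVec m) :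
    (∑ k ∈ S, ‖c k‖) ^ 2 ≤ (∑ k ∈ S, (freqSq k ^ s)⁻¹) * energy s S c := by
  refine Finset.sum_sq_le_sum_mul_sum_of_sq_le_mul S
    (fun k _ => inv_nonneg.2 (pow_nonneg (freqSq_nonneg k) s))
    (fun k _ => mul_nonneg (pow_nonneg (freqSq_nonneg k) s) (sq_nonneg _)) fun k hk => ?_
  have : freqSq k ^ s ≠ 0 := (pow_pos (freqSq_pos fun h => hS (h ▸ hk)) s).ne'
  rw [inv_mul_cancel_left₀ this]

theorem norm_two_pi_I_mul_pow_sq (k : ℤ) (n : ℕ) :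
    ‖(2 * Real.pi * Complex.I * k : ℂ) ^ n‖ ^ 2 = (2 * Real.pi) ^ (2 * n) * (k : ℝ) ^ (2 * n) := by
  rw [norm_pow, norm_mul, norm_mul, norm_mul, Complex.norm_I, Complex.norm_intCast]
  simp only [Complex.norm_ofNat, Complex.norm_real, mul_one, Real.norm_of_nonneg Real.pi_pos.le]
  rw [← pow_mul, mul_comm n 2, mul_pow, pow_mul |(k : ℝ)|, sq_abs, ← pow_mul]

/-- A trigonometric polynomial is controlled by the energy of its coefficients. -/
theorem exists_sobolevBound_trigPoly (hs : (d : ℝ) / 2 < s) (R : ℝ) :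
    ∃ A' R', ∀ {m : ℕ} (S : Finset (Fin d → ℤ)) (c : (Fin d → ℤ) → CVec m), energy s S c ≤ R →
      SobolevBound s A' R' (trigPoly S c) := by
  obtain ⟨Z, hZ, h⟩ := exists_sum_inv_freqSq_le hs
  -- The reference constant is the mean c(0), when present: the energy says nothing about its size,
  -- only about the deviation from it.
  refine ⟨Real.sqrt (Z * R), (2 * Real.pi) ^ (2 * s) * R, fun {m} S c hc =>
    ⟨isSmooth_trigPoly s S c, ⟨if 0 ∈ S then c 0 else 0, fun x => ?_⟩, fun i => ?_⟩⟩
  · have h1 : trigPoly S c x - (if 0 ∈ S then c 0 else 0) =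
        ∑ k ∈ S.erase 0, mFourier k x • c k := by
      split_ifs with h0
      · rw [trigPoly, ← Finset.add_sum_erase S _ h0]
        simp [mFourier_zero]
      · rw [trigPoly, Finset.erase_eq_of_notMem h0, sub_zero]
    rw [h1]
    refine (norm_sum_le _ _).trans (Real.le_sqrt_of_sq_le ?_)
    simp only [norm_smul, norm_mFourier_apply, one_mul]
    refine (sq_sum_norm_le (s := s) (Finset.notMem_erase 0 S) c).trans ?_
    refine mul_le_mul (h _) ((energy_mono (Finset.erase_subset 0 S) c).trans hc) ?_ hZ
    exact Finset.sum_nonneg fun k _ => mul_nonneg (pow_nonneg (freqSq_nonneg k) s) (sq_nonneg _)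
  · rw [iterate_pderiv_trigPoly, integral_norm_trigPoly_sq]
    refine le_trans ?_ (mul_le_mul_of_nonneg_left hc (by positivity))
    rw [energy, Finset.mul_sum]
    refine Finset.sum_le_sum fun k _ => ?_
    rw [norm_smul, mul_pow, norm_two_pi_I_mul_pow_sq, mul_assoc]
    gcongr
    rw [pow_mul, freqSq]
    exact pow_le_pow_left₀ (sq_nonneg _) (Finset.single_le_sum (f := fun i => (k i : ℝ) ^ 2)
      (fun _ _ => sq_nonneg _) (Finset.mem_univ i)) s

/-- Conversely, the Fourier coefficients of a function of class `Cˢ` have bounded energy. -/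
theorem energy_fourierCoeff_le (hs : 1 ≤ s) {A R : ℝ} {f : Torus d → RVec m}
    (hf : SobolevBound s A R f) (S : Finset (Fin d → ℤ)) :
    energy s S (fourierCoeff f) ≤ (d : ℝ) ^ (s - 1) * (d * R) := by
  have hfc : SobolevBound s (1 * A) (1 ^ 2 * R) fun x => toC (f x) :=
    hf.clm (toCL m) norm_toCL_le
  have h1 : ∀ i, ∑ k ∈ S, (k i : ℝ) ^ (2 * s) * ‖fourierCoeff f k‖ ^ 2 ≤ R := by
    intro i
    have hb := (sum_norm_coeff_sq_le S (hfc.smooth.continuous_iterate le_rfl i)).trans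
      (hfc.integral_le i)
    rw [one_pow, one_mul] at hb
    refine le_trans (Finset.sum_le_sum fun k _ => ?_) hb
    rw [coeff_iterate_pderiv hfc.smooth, fourierCoeff_eq_coeff hf.smooth.continuous, norm_smul,
      mul_pow, norm_two_pi_I_mul_pow_sq]
    gcongr
    have : (1 : ℝ) ≤ (2 * Real.pi) ^ (2 * s) :=
      one_le_pow₀ (by linarith [Real.pi_gt_three])
    exact le_mul_of_one_le_left (by rw [pow_mul]; positivity) this
  calc energy s S (fourierCoeff f)
      ≤ ∑ k ∈ S, (d : ℝ) ^ (s - 1) * ∑ i, (k i : ℝ) ^ (2 * s) * ‖fourierCoeff f k‖ ^ 2 := by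
        refine Finset.sum_le_sum fun k _ => ?_
        rw [← Finset.sum_mul, ← mul_assoc]
        gcongr
        exact freqSq_pow_le hs k
    _ = (d : ℝ) ^ (s - 1) * ∑ i, ∑ k ∈ S, (k i : ℝ) ^ (2 * s) * ‖fourierCoeff f k‖ ^ 2 := by
        rw [← Finset.mul_sum, Finset.sum_comm]
    _ ≤ (d : ℝ) ^ (s - 1) * ∑ _i : Fin d, R := by
        gcongr with i
        exact h1 i
    _ = _ := by simp

theorem summable_norm_of_energy_le (hs : (d : ℝ) / 2 < s) {R : ℝ} {c : (Fin d → ℤ) → CVec m}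
    (hc : ∀ S, energy s S c ≤ R) : Summable fun k => ‖c k‖ := by
  obtain ⟨Z, hZ, h⟩ := exists_sum_inv_freqSq_le hs
  refine summable_of_sum_le (fun _ => norm_nonneg _) (c := ‖c 0‖ + Real.sqrt (Z * R)) fun S => ?_
  have h1 : ∑ k ∈ S, ‖c k‖ ≤ ‖c 0‖ + ∑ k ∈ S.erase 0, ‖c k‖ := by
    by_cases h0 : (0 : Fin d → ℤ) ∈ S
    · rw [Finset.add_sum_erase S (fun k => ‖c k‖) h0]
    · rw [Finset.erase_eq_of_notMem h0]
      exact le_add_of_nonneg_left (norm_nonneg _)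
  refine h1.trans (add_le_add le_rfl (Real.le_sqrt_of_sq_le ?_))
  refine (sq_sum_norm_le (s := s) (Finset.notMem_erase 0 S) c).trans (mul_le_mul (h _) (hc _) ?_ hZ)
  exact Finset.sum_nonneg fun k _ => mul_nonneg (pow_nonneg (freqSq_nonneg k) s) (sq_nonneg _)

/-- The Weierstrass M-test gives uniform convergence; the limit is identified componentwise by the
pointwise Fourier inversion theorem. -/
theorem tendstoUniformly_trigPoly {f : Torus d → RVec m} (hf : Continuous f)
    (hsum : Summable fun k => ‖fourierCoeff f k‖) :
    TendstoUniformly (fun S => trigPoly S (fourierCoeff f)) (fun x => toC (f x)) atTop := by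
  have hb : ∀ (k : Fin d → ℤ) (x : Torus d), ‖mFourier k x • fourierCoeff f k‖ ≤ ‖fourierCoeff f k‖ :=
    fun k x => by rw [norm_smul, norm_mFourier_apply, one_mul]
  have h := tendstoUniformly_tsum hsum hb
  convert! h using 1
  funext x
  ext j
  have hsx : Summable fun k => mFourier k x • fourierCoeff f k :=
    .of_norm_bounded hsum fun k => hb k x
  let g : C(Torus d, ℂ) := comp ⟨f, hf⟩ j
  have hg : ∀ k, mFourierCoeff g k = fourierCoeff f k j := fun k => rfl
  have hgs : Summable (mFourierCoeff g) :=
    .of_norm_bounded hsum fun k => by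
      rw [hg]
      exact PiLp.norm_apply_le _ j
  have h1 := hasSum_mFourier_series_apply_of_summable hgs x
  have h2 := (EuclideanSpace.proj (𝕜 := ℂ) j).hasSum hsx.hasSum
  have h3 : (fun k => mFourierCoeff g k • mFourier k x) =
      fun k => EuclideanSpace.proj (𝕜 := ℂ) j (mFourier k x • fourierCoeff f k) := by
    funext k
    simp [hg, mul_comm]
  rw [h3] at h1
  exact h1.unique h2

end Decay

/-! ### Discrete Fourier transform and aliasing -/

section Grid

open UnitAddTorus

variable {d m s N : ℕ}

theorem mFourier_gridPoint (l : Fin d → ℤ) (n : Fin d → Fin N) :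
    mFourier l (gridPoint n) = ∏ i, Complex.exp (2 * Real.pi * Complex.I * l i / N) ^ (n i : ℕ) := by
  simp only [mFourier, ContinuousMap.coe_mk, gridPoint, fourier_coe_apply]
  refine Finset.prod_congr rfl fun i _ => ?_
  rw [← Complex.exp_nat_mul]
  congr 1
  push_cast
  ring

theorem sum_exp_pow (hN : N ≠ 0) (l : ℤ) :
    ∑ j : Fin N, Complex.exp (2 * Real.pi * Complex.I * l / N) ^ (j : ℕ) =
      if (N : ℤ) ∣ l then (N : ℂ) else 0 := by
  have hN' : (N : ℂ) ≠ 0 := by exact_mod_cast hN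
  have hpi : (2 * Real.pi * Complex.I : ℂ) ≠ 0 := Complex.two_pi_I_ne_zero
  split_ifs with h
  · obtain ⟨r, rfl⟩ := h
    have : Complex.exp (2 * Real.pi * Complex.I * ((N * r : ℤ) : ℂ) / N) = 1 := by
      rw [Complex.exp_eq_one_iff]
      refine ⟨r, ?_⟩
      push_cast
      field_simp
    simp only [this, one_pow]
    simp
  · rw [Fin.sum_univ_eq_sum_range (fun j => Complex.exp (2 * Real.pi * Complex.I * l / N) ^ j) N]
    have h1 : Complex.exp (2 * Real.pi * Complex.I * l / N) ≠ 1 := by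
      intro h1
      obtain ⟨r, hr⟩ := Complex.exp_eq_one_iff.1 h1
      refine h ⟨r, ?_⟩
      have h2 : (2 * Real.pi * Complex.I : ℂ) * l = (2 * Real.pi * Complex.I) * (N * r) := by
        field_simp at hr
        linear_combination (2 * Real.pi * Complex.I) * hr
      exact_mod_cast mul_left_cancel₀ hpi h2
    have h2 : Complex.exp (2 * Real.pi * Complex.I * l / N) ^ N = 1 := by
      rw [← Complex.exp_nat_mul, Complex.exp_eq_one_iff]
      refine ⟨l, ?_⟩
      field_simp
    have h3 := geom_sum_mul (Complex.exp (2 * Real.pi * Complex.I * l / N)) N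
    rw [h2, sub_self, mul_eq_zero] at h3
    exact h3.resolve_right (sub_ne_zero.2 h1)

theorem sum_mFourier_gridPoint (hN : N ≠ 0) (l : Fin d → ℤ) :
    ∑ n : Fin d → Fin N, mFourier l (gridPoint n) =
      if ∀ i, (N : ℤ) ∣ l i then (N : ℂ) ^ d else 0 := by
  simp only [mFourier_gridPoint]
  rw [← Fintype.piFinset_univ, ← Finset.prod_univ_sum (fun _ => Finset.univ)
    (fun i (j : Fin N) => Complex.exp (2 * Real.pi * Complex.I * l i / N) ^ (j : ℕ))]
  simp only [sum_exp_pow hN]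
  split_ifs with h
  · simp [h]
  · push Not at h
    obtain ⟨i, hi⟩ := h
    exact Finset.prod_eq_zero (Finset.mem_univ i) (if_neg hi)

/-- The discrete Fourier transform of a complex vector-valued grid function. -/
def gridCoeff (g : (Fin d → Fin N) → CVec m) (k : Fin d → ℤ) : CVec m :=
  ((N : ℂ) ^ d)⁻¹ • ∑ n, mFourier (-k) (gridPoint n) • g n

theorem dft_eq_gridCoeff (v : (Fin d → Fin N) → RVec m) (k : Fin d → ℤ) :
    dft v k = gridCoeff (fun n => toC (v n)) k := rfl

open Classical in
-- Aliasing in exact form: frequencies congruent modulo N agree on the grid, and the others are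
-- orthogonal there.
theorem gridCoeff_trigPoly (hN : N ≠ 0) (S : Finset (Fin d → ℤ)) (c : (Fin d → ℤ) → CVec m)
    (k : Fin d → ℤ) :
    gridCoeff (fun n : Fin d → Fin N => trigPoly S c (gridPoint n)) k =
      ∑ l ∈ S with ∀ i, (N : ℤ) ∣ l i - k i, c l := by
  have hN' : ((N : ℂ) ^ d) ≠ 0 := pow_ne_zero _ (by exact_mod_cast hN)
  unfold gridCoeff trigPoly
  simp only [Finset.smul_sum, smul_smul, ← mFourier_add]
  rw [Finset.sum_comm, Finset.sum_filter]
  refine Finset.sum_congr rfl fun l _ => ?_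
  rw [← Finset.sum_smul, ← Finset.mul_sum, sum_mFourier_gridPoint hN]
  simp only [Pi.add_apply, Pi.neg_apply, neg_add_eq_sub]
  split_ifs with h
  · rw [inv_mul_cancel₀ hN', one_smul]
  · simp

theorem norm_gridCoeff_le {g : (Fin d → Fin N) → CVec m} {ε : ℝ} (hε : 0 ≤ ε)
    (hg : ∀ n, ‖g n‖ ≤ ε) (k : Fin d → ℤ) : ‖gridCoeff g k‖ ≤ ε := by
  unfold gridCoeff
  rw [norm_smul]
  have h1 : ‖∑ n, mFourier (-k) (gridPoint n) • g n‖ ≤ (N : ℝ) ^ d * ε := by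
    refine (norm_sum_le_of_le _ (f := fun n => mFourier (-k) (gridPoint n) • g n)
      (n := fun _ => ε) fun n _ => ?_).trans (by simp)
    rw [norm_smul, norm_mFourier_apply, one_mul]
    exact hg n
  rw [norm_inv, norm_pow, Complex.norm_natCast]
  rcases eq_or_ne ((N : ℝ) ^ d) 0 with h0 | h0
  · simpa [h0] using hε
  · have : 0 < (N : ℝ) ^ d := lt_of_le_of_ne (by positivity) h0.symm
    rw [inv_mul_le_iff₀ this]
    exact h1

theorem gridCoeff_sub (g h : (Fin d → Fin N) → CVec m) (k : Fin d → ℤ) :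
    gridCoeff (fun n => g n - h n) k = gridCoeff g k - gridCoeff h k := by
  simp only [gridCoeff, smul_sub, Finset.sum_sub_distrib]

/-- A bound for a single frequency is enough: summation over k is later paid for by the
square-summable multipliers. -/
theorem norm_gridCoeff_sq_le (g : (Fin d → Fin N) → CVec m) (k : Fin d → ℤ) :
    (N : ℝ) ^ d * ‖gridCoeff g k‖ ^ 2 ≤ ∑ n, ‖g n‖ ^ 2 := by
  have h1 : ‖∑ n, mFourier (-k) (gridPoint n) • g n‖ ^ 2 ≤ (N : ℝ) ^ d * ∑ n, ‖g n‖ ^ 2 := by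
    refine (pow_le_pow_left₀ (norm_nonneg _) (norm_sum_le _ _) 2).trans ?_
    simp only [norm_smul, norm_mFourier_apply, one_mul]
    refine sq_sum_le_card_mul_sum_sq.trans (le_of_eq ?_)
    simp
  rw [gridCoeff, norm_smul, norm_inv, norm_pow, Complex.norm_natCast, mul_pow]
  rcases eq_or_ne ((N : ℝ) ^ d) 0 with h0 | h0
  · rw [h0, zero_mul]
    positivity
  · have hp : 0 < (N : ℝ) ^ d := lt_of_le_of_ne (by positivity) h0.symm
    calc (N : ℝ) ^ d * (((N : ℝ) ^ d)⁻¹ ^ 2 * ‖∑ n, mFourier (-k) (gridPoint n) • g n‖ ^ 2)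
        ≤ (N : ℝ) ^ d * (((N : ℝ) ^ d)⁻¹ ^ 2 * ((N : ℝ) ^ d * ∑ n, ‖g n‖ ^ 2)) := by gcongr
      _ = _ := by field_simp

/-- Discrete Parseval identity for frequencies that the grid separates. -/
theorem sum_norm_trigPoly_gridPoint_sq (hN : N ≠ 0) (S : Finset (Fin d → ℤ))
    (hS : ∀ k ∈ S, ∀ l ∈ S, (∀ i, (N : ℤ) ∣ l i - k i) → l = k) (c : (Fin d → ℤ) → CVec m) :
    ∑ n : Fin d → Fin N, ‖trigPoly S c (gridPoint n)‖ ^ 2 = (N : ℝ) ^ d * ∑ k ∈ S, ‖c k‖ ^ 2 := by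
  classical
  have hN' : ((N : ℂ) ^ d) ≠ 0 := pow_ne_zero _ (by exact_mod_cast hN)
  have h1 : ∀ k ∈ S, ∑ n : Fin d → Fin N, mFourier (-k) (gridPoint n) •
      trigPoly S c (gridPoint n) = ((N : ℂ) ^ d) • c k := by
    intro k hk
    have h := gridCoeff_trigPoly hN S c k
    have hf : (S.filter fun l => ∀ i, (N : ℤ) ∣ l i - k i) = {k} := by
      ext l
      simp only [Finset.mem_filter, Finset.mem_singleton]
      exact ⟨fun hl => hS k hk l hl.1 hl.2, fun hl => by subst hl; simp [hk]⟩
    rw [hf, Finset.sum_singleton, gridCoeff, inv_smul_eq_iff₀ hN'] at h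
    exact h
  have h2 : ∑ n : Fin d → Fin N, inner ℂ (trigPoly S c (gridPoint n)) (trigPoly S c (gridPoint n)) =
      ∑ k ∈ S, inner ℂ (c k) (((N : ℂ) ^ d) • c k) := by
    have h3 : ∀ n : Fin d → Fin N,
        inner ℂ (trigPoly S c (gridPoint n)) (trigPoly S c (gridPoint n)) =
          ∑ k ∈ S, inner ℂ (c k) (mFourier (-k) (gridPoint n) • trigPoly S c (gridPoint n)) := by
      intro n
      conv_lhs => enter [2]; unfold trigPoly
      simp only [sum_inner, inner_smul_left, inner_smul_right, mFourier_neg]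
    simp only [h3]
    rw [Finset.sum_comm]
    refine Finset.sum_congr rfl fun k hk => ?_
    rw [← inner_sum, h1 k hk]
  simp only [inner_smul_right, inner_self_eq_norm_sq_to_K] at h2
  rw [← Finset.mul_sum] at h2
  have h4 : ((∑ n : Fin d → Fin N, ‖trigPoly S c (gridPoint n)‖ ^ 2 : ℝ) : ℂ) =
      (((N : ℝ) ^ d * ∑ k ∈ S, ‖c k‖ ^ 2 : ℝ) : ℂ) := by
    push_cast
    exact h2
  exact_mod_cast h4

/-- In each coordinate with qᵢ ≠ 0, |lᵢ| ≥ N|qᵢ| - N/4 ≥ N|qᵢ|/2; where qᵢ = 0 there is nothing to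
show. -/
theorem freqSq_ge_of_dvd_sub {k l q : Fin d → ℤ} (hk : ∀ i, 4 * |k i| ≤ N)
    (hq : ∀ i, l i - k i = N * q i) : (N : ℝ) ^ 2 / 4 * freqSq q ≤ freqSq l := by
  unfold freqSq
  rw [Finset.mul_sum]
  refine Finset.sum_le_sum fun i _ => ?_
  have h1 : (N : ℤ) * |q i| ≤ 2 * |l i| := by
    rcases eq_or_ne (q i) 0 with h0 | h0
    · simp [h0]
    · have h2 : 1 ≤ |q i| := Int.one_le_abs h0
      have h3 : (N : ℤ) * |q i| = |l i - k i| := by rw [hq, abs_mul, Nat.abs_cast]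
      have h4 := abs_sub (l i) (k i)
      have h5 := hk i
      nlinarith [Nat.cast_nonneg (α := ℤ) N]
  have h2 : ((N : ℝ) * |(q i : ℝ)|) ≤ 2 * |(l i : ℝ)| := by exact_mod_cast h1
  have h3 := pow_le_pow_left₀ (by positivity) h2 2
  rw [mul_pow, mul_pow, sq_abs, sq_abs] at h3
  linarith

open Classical in
-- The map l ↦ q = (l - k)/N is injective on aliases and avoids 0 because l ≠ k. Comparing |l| with
-- N|q|/2 extracts the factor N^{-2s} and leaves a sum over distinct lattice points q.
theorem exists_sum_alias_le (hs : (d : ℝ) / 2 < s) :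
    ∃ Z, 0 ≤ Z ∧ ∀ {N : ℕ}, N ≠ 0 → ∀ {k : Fin d → ℤ}, (∀ i, 4 * |k i| ≤ N) →
      ∀ S : Finset (Fin d → ℤ), (∀ l ∈ S, l ≠ k ∧ ∀ i, (N : ℤ) ∣ l i - k i) →
        (0 : Fin d → ℤ) ∉ S ∧ ∑ l ∈ S, (freqSq l ^ s)⁻¹ ≤ Z * ((N : ℝ) ^ (2 * s))⁻¹ := by
  obtain ⟨Z, hZ, h⟩ := exists_sum_inv_freqSq_le hs
  refine ⟨4 ^ s * Z, by positivity, fun {N} hN {k} hk S hS => ?_⟩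
  have hN' : (0 : ℝ) < N := by exact_mod_cast Nat.pos_of_ne_zero hN
  set q : (Fin d → ℤ) → (Fin d → ℤ) := fun l i => (l i - k i) / N with hqdef
  have hq : ∀ l ∈ S, ∀ i, l i - k i = N * q l i := fun l hl i =>
    (Int.mul_ediv_cancel' ((hS l hl).2 i)).symm
  have hge : ∀ l ∈ S, (N : ℝ) ^ 2 / 4 * freqSq (q l) ≤ freqSq l := fun l hl =>
    freqSq_ge_of_dvd_sub hk (hq l hl)
  have hq0 : ∀ l ∈ S, q l ≠ 0 := by
    intro l hl h0
    refine (hS l hl).1 (funext fun i => ?_)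
    have := hq l hl i
    rw [h0] at this
    simpa [sub_eq_zero] using this
  have hpos : ∀ l ∈ S, 0 < (N : ℝ) ^ 2 / 4 * freqSq (q l) := fun l hl =>
    mul_pos (by positivity) (freqSq_pos (hq0 l hl))
  constructor
  · intro h0
    have := (hpos 0 h0).trans_le (hge 0 h0)
    simp [freqSq] at this
  · calc ∑ l ∈ S, (freqSq l ^ s)⁻¹
        ≤ ∑ l ∈ S, 4 ^ s * ((N : ℝ) ^ (2 * s))⁻¹ * (freqSq (q l) ^ s)⁻¹ := by
          refine Finset.sum_le_sum fun l hl => ?_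
          have e : 4 ^ s * ((N : ℝ) ^ (2 * s))⁻¹ * (freqSq (q l) ^ s)⁻¹ =
              (((N : ℝ) ^ 2 / 4 * freqSq (q l)) ^ s)⁻¹ := by
            rw [mul_pow, div_pow, ← pow_mul, mul_inv, inv_div]
            ring
          rw [e]
          have := hpos l hl
          gcongr
          exact hge l hl
      _ = 4 ^ s * ((N : ℝ) ^ (2 * s))⁻¹ * ∑ r ∈ S.image q, (freqSq r ^ s)⁻¹ := by
          rw [← Finset.mul_sum, Finset.sum_image]
          intro l hl l' hl' hll
          funext i
          have h1 := hq l hl i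
          have h2 := hq l' hl' i
          rw [hll] at h1
          linarith
      _ ≤ 4 ^ s * ((N : ℝ) ^ (2 * s))⁻¹ * Z := by
          gcongr
          exact h _
      _ = _ := by ring

/-- **Aliasing estimate**: the discrete Fourier transform of a function of bounded energy is
close to its Fourier transform at low frequencies. -/
theorem exists_norm_fourierCoeff_sub_dft_le (hs : (d : ℝ) / 2 < s) (R : ℝ) :
    ∃ C, 0 ≤ C ∧ ∀ {m N : ℕ} {f : Torus d → RVec m}, N ≠ 0 → Continuous f →
      (∀ S, energy s S (fourierCoeff f) ≤ R) → ∀ k : Fin d → ℤ, (∀ i, 4 * |k i| ≤ N) →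
        ‖fourierCoeff f k - dft (fun n : Fin d → Fin N => f (gridPoint n)) k‖ ≤
          C * ((N : ℝ) ^ s)⁻¹ := by
  classical
  obtain ⟨Z, hZ, h⟩ := exists_sum_alias_le hs
  refine ⟨Real.sqrt (Z * R), Real.sqrt_nonneg _, fun {m N f} hN hf hE k hk => ?_⟩
  -- The transform on the grid is a finite sum, so it is the limit of the transforms of the partial
  -- Fourier sums. For these the aliasing formula is exact, and once S contains k the term l = k
  -- cancels the true coefficient.
  have hlim := (tendstoUniformly_trigPoly hf (summable_norm_of_energy_le hs hE)).tendsto_at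
  have hgrid : Tendsto (fun S => gridCoeff (fun n : Fin d → Fin N =>
      trigPoly S (fourierCoeff f) (gridPoint n)) k) atTop
      (𝓝 (dft (fun n : Fin d → Fin N => f (gridPoint n)) k)) := by
    rw [dft_eq_gridCoeff]
    unfold gridCoeff
    exact (tendsto_finsetSum _ fun n _ => (hlim (gridPoint n)).const_smul _).const_smul _
  refine le_of_tendsto (hgrid.const_sub (fourierCoeff f k)).norm ?_
  filter_upwards [eventually_ge_atTop {k}] with S hS
  have hkS : k ∈ S := hS (Finset.mem_singleton_self k)
  rw [gridCoeff_trigPoly hN]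
  have hkf : k ∈ S.filter fun l => ∀ i, (N : ℤ) ∣ l i - k i := by simp [hkS]
  rw [← Finset.add_sum_erase _ _ hkf, sub_add_cancel_left, norm_neg]
  set T := (S.filter fun l => ∀ i, (N : ℤ) ∣ l i - k i).erase k with hT
  obtain ⟨h0, hZT⟩ := h hN hk T fun l hl =>
    ⟨Finset.ne_of_mem_erase hl, (Finset.mem_filter.1 (Finset.mem_of_mem_erase hl)).2⟩
  have hR : 0 ≤ R := by simpa [energy] using hE ∅
  have h1 : (∑ l ∈ T, ‖fourierCoeff f l‖) ^ 2 ≤ Z * ((N : ℝ) ^ (2 * s))⁻¹ * R :=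
    (sq_sum_norm_le (s := s) h0 _).trans (mul_le_mul hZT (hE T)
      (Finset.sum_nonneg fun l _ => mul_nonneg (pow_nonneg (freqSq_nonneg l) s) (sq_nonneg _))
      (by positivity))
  refine (norm_sum_le _ _).trans (le_of_sq_le_sq ?_ (by positivity))
  refine h1.trans (le_of_eq ?_)
  rw [mul_pow, Real.sq_sqrt (by positivity), inv_pow, ← pow_mul, mul_comm s 2]
  ring

end Grid

/-! ### Grid norms and matrix norms -/

section GridNorm

variable {d N m m' : ℕ}

theorem ell2Norm_nonneg (u : (Fin d → Fin N) → RVec m) : 0 ≤ ell2Norm u := Real.sqrt_nonneg _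

theorem ell2Norm_sq (u : (Fin d → Fin N) → RVec m) : ell2Norm u ^ 2 = ∑ n, ‖u n‖ ^ 2 :=
  Real.sq_sqrt (Finset.sum_nonneg fun _ _ => sq_nonneg _)

theorem ell2Norm_add_le (u v : (Fin d → Fin N) → RVec m) :
    ell2Norm (fun n => u n + v n) ≤ ell2Norm u + ell2Norm v := by
  have h : ∀ w : (Fin d → Fin N) → RVec m,
      ell2Norm w = ‖(WithLp.toLp 2 w : PiLp 2 fun _ : Fin d → Fin N => RVec m)‖ :=
    fun w => by rw [PiLp.norm_eq_of_L2]; rfl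
  rw [h, h, h]
  exact norm_add_le (WithLp.toLp 2 u : PiLp 2 fun _ : Fin d → Fin N => RVec m) (WithLp.toLp 2 v)

theorem ell2Norm_le_mul {c : ℝ} (hc : 0 ≤ c) {u : (Fin d → Fin N) → RVec m}
    {v : (Fin d → Fin N) → RVec m'} (h : ∀ n, ‖u n‖ ≤ c * ‖v n‖) :
    ell2Norm u ≤ c * ell2Norm v := by
  refine Real.sqrt_le_iff.2 ⟨mul_nonneg hc (ell2Norm_nonneg v), ?_⟩
  rw [mul_pow, ell2Norm_sq, Finset.mul_sum]
  refine Finset.sum_le_sum fun n _ => ?_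
  rw [← mul_pow]
  exact pow_le_pow_left₀ (norm_nonneg _) (h n) 2

theorem ell2Norm_le_of_forall_le {u : (Fin d → Fin N) → RVec m} {ε : ℝ} (hε : 0 ≤ ε)
    (h : ∀ n, ‖u n‖ ≤ ε) : ell2Norm u ≤ Real.sqrt ((N : ℝ) ^ d) * ε := by
  refine Real.sqrt_le_iff.2 ⟨by positivity, ?_⟩
  rw [mul_pow, Real.sq_sqrt (by positivity)]
  calc ∑ n, ‖u n‖ ^ 2 ≤ ∑ _n : Fin d → Fin N, ε ^ 2 :=
        Finset.sum_le_sum fun n _ => pow_le_pow_left₀ (norm_nonneg _) (h n) 2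
    _ = _ := by simp

theorem norm_toEuclideanLin_sq_le {𝕜 : Type*} [RCLike 𝕜] (P : Matrix (Fin m') (Fin m) 𝕜)
    (v : EuclideanSpace 𝕜 (Fin m)) :
    ‖Matrix.toEuclideanLin P v‖ ^ 2 ≤ frobSq P * ‖v‖ ^ 2 := by
  rw [EuclideanSpace.norm_sq_eq, EuclideanSpace.norm_sq_eq, frobSq, Finset.sum_mul]
  refine Finset.sum_le_sum fun i _ => ?_
  have h : ‖Matrix.toEuclideanLin P v i‖ ≤ ∑ j, ‖P i j‖ * ‖v j‖ := by
    have e : Matrix.toEuclideanLin P v i = ∑ j, P i j * v j := rfl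
    rw [e]
    exact norm_sum_le_of_le _ fun j _ => (norm_mul _ _).le
  exact (pow_le_pow_left₀ (norm_nonneg _) h 2).trans (Finset.sum_mul_sq_le_sq_mul_sq _ _ _)

theorem frobSq_nonneg {𝕜 : Type*} [RCLike 𝕜] (P : Matrix (Fin m') (Fin m) 𝕜) : 0 ≤ frobSq P :=
  Finset.sum_nonneg fun _ _ => Finset.sum_nonneg fun _ _ => sq_nonneg _

theorem norm_toEuclideanLin_le {𝕜 : Type*} [RCLike 𝕜] {P : Matrix (Fin m') (Fin m) 𝕜} {M : ℝ}
    (hM : 0 ≤ M) (hP : frobSq P ≤ M ^ 2) (v : EuclideanSpace 𝕜 (Fin m)) :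
    ‖Matrix.toEuclideanLin P v‖ ≤ M * ‖v‖ := by
  refine le_of_sq_le_sq ?_ (by positivity)
  rw [mul_pow]
  exact (norm_toEuclideanLin_sq_le P v).trans (mul_le_mul_of_nonneg_right hP (sq_nonneg _))

/-- Here K < N/2 is turned into the gap that keeps aliases away: |kᵢ| ≤ K/2 < N/4. -/
theorem four_mul_abs_le_of_mem_symIndexBox {K : ℕ} (hK : 2 * K < N) {k : Fin d → ℤ}
    (hk : k ∈ symIndexBox d K) (i : Fin d) : 4 * |k i| ≤ N := by
  have h := Fintype.mem_piFinset.1 hk i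
  rw [symIndex, Finset.mem_Ico] at h
  have : |k i| ≤ (K / 2 : ℕ) := abs_le.2 (by omega)
  omega

theorem eq_of_mem_symIndexBox {K : ℕ} (hK : 2 * K < N) {k l : Fin d → ℤ}
    (hk : k ∈ symIndexBox d K) (hl : l ∈ symIndexBox d K) (h : ∀ i, (N : ℤ) ∣ l i - k i) :
    l = k := by
  funext i
  have h1 := four_mul_abs_le_of_mem_symIndexBox hK hk i
  have h2 := four_mul_abs_le_of_mem_symIndexBox hK hl i
  refine sub_eq_zero.1 (Int.eq_zero_of_abs_lt_dvd (h i) ?_)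
  have := abs_sub (l i) (k i)
  omega

end GridNorm

/-! ### States of Fourier neural operators -/

section Model

variable {d da s : ℕ} {B M : ℝ}

theorem norm_fourierCoeff_sub_le {m : ℕ} {f g : Torus d → RVec m} (hf : Continuous f)
    (hg : Continuous g) {ε : ℝ} (h : ∀ x, ‖f x - g x‖ ≤ ε) (k : Fin d → ℤ) :
    ‖fourierCoeff f k - fourierCoeff g k‖ ≤ ε := by
  have hi : ∀ {v : Torus d → RVec m}, Continuous v →
      Integrable (fun x => UnitAddTorus.mFourier (-k) x • toC (v x)) (haar d) := fun hv =>
    integrable_of_continuous ((UnitAddTorus.mFourier (-k)).continuous.smul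
      ((toCL m).continuous.comp hv))
  rw [fourierCoeff_eq_coeff hf, fourierCoeff_eq_coeff hg, coeff, coeff,
    ← integral_sub (hi hf) (hi hg)]
  refine (norm_integral_le_of_norm_le_const (C := ε) (ae_of_all _ fun x => ?_)).trans (by simp)
  rw [← smul_sub, norm_smul, norm_mFourier_apply, one_mul, ← toCL_apply, ← toCL_apply, ← map_sub,
    toCL_apply, norm_toC]
  exact h x

theorem dft_sub {N m : ℕ} (u v : (Fin d → Fin N) → RVec m) (k : Fin d → ℤ) :
    dft u k - dft v k = gridCoeff (fun n => toC (u n - v n)) k := by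
  rw [dft_eq_gridCoeff, dft_eq_gridCoeff, ← gridCoeff_sub]
  simp only [← toCL_apply, map_sub]

theorem norm_dft_sub_le {N m : ℕ} {u v : (Fin d → Fin N) → RVec m} {ε : ℝ} (hε : 0 ≤ ε)
    (h : ∀ n, ‖u n - v n‖ ≤ ε) (k : Fin d → ℤ) : ‖dft u k - dft v k‖ ≤ ε := by
  rw [dft_sub]
  exact norm_gridCoeff_le hε (fun n => by rw [norm_toC]; exact h n) k

theorem sqrt_mul_norm_dft_sub_le {N m : ℕ} (u v : (Fin d → Fin N) → RVec m) (k : Fin d → ℤ) :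
    Real.sqrt ((N : ℝ) ^ d) * ‖dft u k - dft v k‖ ≤ ell2Norm fun n => u n - v n := by
  rw [dft_sub]
  refine Real.le_sqrt_of_sq_le ?_
  rw [mul_pow, Real.sq_sqrt (by positivity)]
  refine (norm_gridCoeff_sq_le _ k).trans (le_of_eq ?_)
  simp only [norm_toC]

namespace Model

variable (F : Model d da)

theorem synth_eq (t : ℕ) (c : (Fin d → ℤ) → CVec (F.width t)) (x : Torus d) :
    F.synth t c x = rePart (trigPoly (symIndexBox d F.modes)
      (fun k => Matrix.toEuclideanLin (F.mult t k) (c k)) x) := rfl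

theorem synth_sub (t : ℕ) (c c' : (Fin d → ℤ) → CVec (F.width t)) (x : Torus d) :
    F.synth t c x - F.synth t c' x = F.synth t (fun k => c k - c' k) x := by
  simp only [synth_eq, ← rePartL_apply, ← map_sub, trigPoly, ← Finset.sum_sub_distrib, ← smul_sub]

theorem continuous_synth (t : ℕ) (c : (Fin d → ℤ) → CVec (F.width t)) :
    Continuous (F.synth t c) :=
  (rePartL _).continuous.comp (continuous_trigPoly _ _)

theorem norm_rePart_le {m : ℕ} (w : CVec m) : ‖rePart w‖ ≤ ‖w‖ := by
  simpa using (rePartL m).le_of_opNorm_le norm_rePartL_le w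

variable {F}

theorem Admissible.sum_frobSq_mult_le (hF : F.Admissible s B M) {t : ℕ} (ht : t < F.depth) :
    ∑ k ∈ symIndexBox d F.modes, frobSq (F.mult t k) ≤ M ^ 2 :=
  (Real.sqrt_le_iff.1 (hF.mult_bound t ht)).2

theorem Admissible.frobSq_mult_le (hF : F.Admissible s B M) {t : ℕ} (ht : t < F.depth)
    {k : Fin d → ℤ} (hk : k ∈ symIndexBox d F.modes) : frobSq (F.mult t k) ≤ M ^ 2 :=
  (Finset.single_le_sum (f := fun k => frobSq (F.mult t k)) (fun _ _ => frobSq_nonneg _) hk).trans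
    (hF.sum_frobSq_mult_le ht)

theorem Admissible.frobSq_liftMat_le (hF : F.Admissible s B M) : frobSq F.liftMat ≤ M ^ 2 :=
  le_trans (le_add_of_nonneg_right (sq_nonneg _)) (Real.sqrt_le_iff.1 hF.lift_bound).2

theorem Admissible.nonneg (hF : F.Admissible s B M) : 0 ≤ M :=
  (Real.sqrt_nonneg _).trans hF.lift_bound

theorem Admissible.norm_weight_apply_le (hF : F.Admissible s B M) {t : ℕ} (ht : t < F.depth)
    (v : RVec (F.width t)) : ‖Matrix.toEuclideanLin (F.weight t) v‖ ≤ M * ‖v‖ :=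
  (LinearMap.toContinuousLinearMap (Matrix.toEuclideanLin (F.weight t))).le_of_opNorm_le
    (hF.weight_bound t ht) v

theorem Admissible.norm_synth_le (hF : F.Admissible s B M) {t : ℕ} (ht : t < F.depth)
    {c : (Fin d → ℤ) → CVec (F.width t)} {ε : ℝ} (hc : ∀ k, ‖c k‖ ≤ ε) (x : Torus d) :
    ‖F.synth t c x‖ ≤ (symIndexBox d F.modes).card * (M * ε) := by
  rw [synth_eq]
  refine (norm_rePart_le _).trans ?_
  rw [← nsmul_eq_mul, ← Finset.sum_const]
  refine norm_sum_le_of_le _ fun k hk => ?_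
  rw [norm_smul, norm_mFourier_apply, one_mul]
  exact (norm_toEuclideanLin_le hF.nonneg (hF.frobSq_mult_le ht hk) _).trans
    (mul_le_mul_of_nonneg_left (hc k) hF.nonneg)

theorem Admissible.continuous_state (hF : F.Admissible s B M) {f : Torus d → RVec da}
    (hf : Continuous f) {t : ℕ} (ht : t ≤ F.depth) : Continuous (F.state f t) := by
  cases t with
  | zero =>
    exact hF.liftAct_bound.1.continuous.comp
      (((Matrix.toEuclideanLin F.liftMat).continuous_of_finiteDimensional.comp hf).add
        continuous_const)
  | succ t =>
    have ih := Admissible.continuous_state hF hf (t := t) (by omega)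
    exact (hF.act_bound t ht).1.continuous.comp
      ((((Matrix.toEuclideanLin (F.weight t)).continuous_of_finiteDimensional.comp ih).add
        (F.continuous_synth t _)).add continuous_const)

/-- The states depend Lipschitz continuously on the input, in the supremum norm. -/
theorem Admissible.exists_lipschitz (hs : 1 ≤ s) (hB : 0 ≤ B) (hF : F.Admissible s B M) {t : ℕ}
    (ht : t ≤ F.depth) :
    ∃ L, 0 ≤ L ∧ ∀ {f g : Torus d → RVec da}, Continuous f → Continuous g → ∀ {ε : ℝ}, 0 ≤ ε →
      (∀ x, ‖f x - g x‖ ≤ ε) →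
        (∀ x, ‖F.state f t x - F.state g t x‖ ≤ L * ε) ∧
        ∀ N n, ‖F.gridState N f t n - F.gridState N g t n‖ ≤ L * ε := by
  have hM := hF.nonneg
  induction t with
  | zero =>
    have h : ∀ u v : RVec da, ‖F.lift u - F.lift v‖ ≤ B * M * ‖u - v‖ := by
      intro u v
      refine (hF.liftAct_bound.norm_sub_le hs _ _).trans ?_
      rw [add_sub_add_right_eq_sub, ← map_sub, mul_assoc]
      exact mul_le_mul_of_nonneg_left (norm_toEuclideanLin_le hM hF.frobSq_liftMat_le _) hB
    refine ⟨B * M, by positivity, fun {f g} _ _ {ε} _ hfg => ⟨fun x => ?_, fun N n => ?_⟩⟩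
    · exact (h _ _).trans (mul_le_mul_of_nonneg_left (hfg x) (by positivity))
    · exact (h _ _).trans (mul_le_mul_of_nonneg_left (hfg _) (by positivity))
  | succ t ih =>
    obtain ⟨L, hL, ih⟩ := ih (by omega)
    have h : ∀ {u v : RVec (F.width t)} {c c' : (Fin d → ℤ) → CVec (F.width t)} (x : Torus d)
        {δ : ℝ}, ‖u - v‖ ≤ δ → (∀ k, ‖c k - c' k‖ ≤ δ) →
        ‖F.act t (Matrix.toEuclideanLin (F.weight t) u + F.synth t c x + F.bias t) -
          F.act t (Matrix.toEuclideanLin (F.weight t) v + F.synth t c' x + F.bias t)‖ ≤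
          B * (M * δ + (symIndexBox d F.modes).card * (M * δ)) := by
      intro u v c c' x δ huv hc
      refine ((hF.act_bound t ht).norm_sub_le hs _ _).trans (mul_le_mul_of_nonneg_left ?_ hB)
      rw [add_sub_add_right_eq_sub, add_sub_add_comm, ← map_sub, synth_sub]
      exact norm_add_le_of_le ((hF.norm_weight_apply_le ht _).trans
        (mul_le_mul_of_nonneg_left huv hM)) (hF.norm_synth_le ht hc x)
    -- This crude constant grows with the number of modes. That is harmless, since it only ever
    -- multiplies an approximation error that can be made arbitrarily small for a fixed model.
    refine ⟨B * (M * L + (symIndexBox d F.modes).card * (M * L)), by positivity,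
      fun {f g} hf hg {ε} hε hfg => ?_⟩
    obtain ⟨h1, h2⟩ := ih hf hg hε hfg
    have e : B * (M * L + (symIndexBox d F.modes).card * (M * L)) * ε =
        B * (M * (L * ε) + (symIndexBox d F.modes).card * (M * (L * ε))) := by ring
    rw [e]
    refine ⟨fun x => ?_, fun N n => ?_⟩
    · exact h x (h1 x) (norm_fourierCoeff_sub_le (hF.continuous_state hf (by omega))
        (hF.continuous_state hg (by omega)) h1)
    · exact h (gridPoint n) (h2 N n) (norm_dft_sub_le (by positivity) (h2 N))

/-- The error of one discretized kernel operator: aliasing plus propagation of earlier errors. -/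
theorem exists_ell2Norm_kernel_sub_le (hs : (d : ℝ) / 2 < s) (B M R : ℝ) :
    ∃ C, 0 ≤ C ∧ ∀ {F : Model d da} {t : ℕ}, F.Admissible s B M → t < F.depth →
      ∀ {N : ℕ}, 2 * F.modes < N → ∀ {f : Torus d → RVec (F.width t)}, Continuous f →
        (∀ S, energy s S (fourierCoeff f) ≤ R) → ∀ v : (Fin d → Fin N) → RVec (F.width t),
          ell2Norm (fun n => F.kernel t f (gridPoint n) - F.gridKernel N t v n) ≤
            M * (Real.sqrt ((N : ℝ) ^ d) * (C * ((N : ℝ) ^ s)⁻¹) +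
              ell2Norm fun n => f (gridPoint n) - v n) := by
  obtain ⟨C, hC, h⟩ := exists_norm_fourierCoeff_sub_dft_le hs R
  refine ⟨C, hC, fun {F t} hF ht {N} hN {f} hf hR v => ?_⟩
  have hN0 : N ≠ 0 := by omega
  have hM := hF.nonneg
  set D := Real.sqrt ((N : ℝ) ^ d) with hD
  set E := D * (C * ((N : ℝ) ^ s)⁻¹) + ell2Norm fun n => f (gridPoint n) - v n with hE
  have hE0 : 0 ≤ E := add_nonneg (by positivity) (ell2Norm_nonneg _)
  -- Uniform in k: aliasing of f itself, plus the transform of the earlier grid error f - v.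
  have hδ : ∀ k ∈ symIndexBox d F.modes, D * ‖fourierCoeff f k - dft v k‖ ≤ E := by
    intro k hk
    have h1 := h hN0 hf hR k (four_mul_abs_le_of_mem_symIndexBox hN hk)
    have h2 := sqrt_mul_norm_dft_sub_le (fun n : Fin d → Fin N => f (gridPoint n)) v k
    have h3 := norm_sub_le_norm_sub_add_norm_sub (fourierCoeff f k)
      (dft (fun n : Fin d → Fin N => f (gridPoint n)) k) (dft v k)
    calc D * ‖fourierCoeff f k - dft v k‖ ≤ D * (_ + _) :=
          mul_le_mul_of_nonneg_left h3 (Real.sqrt_nonneg _)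
      _ = D * _ + D * _ := mul_add _ _ _
      _ ≤ E := add_le_add (mul_le_mul_of_nonneg_left h1 (Real.sqrt_nonneg _)) h2
  refine Real.sqrt_le_iff.2 ⟨mul_nonneg hM hE0, ?_⟩
  have hpt : ∀ n : Fin d → Fin N, F.kernel t f (gridPoint n) - F.gridKernel N t v n =
      rePart (trigPoly (symIndexBox d F.modes) (fun k => Matrix.toEuclideanLin (F.mult t k)
        (fourierCoeff f k - dft v k)) (gridPoint n)) := fun n => F.synth_sub t _ _ _
  calc ∑ n : Fin d → Fin N, ‖F.kernel t f (gridPoint n) - F.gridKernel N t v n‖ ^ 2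
      ≤ ∑ n : Fin d → Fin N, ‖trigPoly (symIndexBox d F.modes) (fun k =>
          Matrix.toEuclideanLin (F.mult t k) (fourierCoeff f k - dft v k)) (gridPoint n)‖ ^ 2 := by
        refine Finset.sum_le_sum fun n _ => ?_
        rw [hpt]
        exact pow_le_pow_left₀ (norm_nonneg _) (norm_rePart_le _) 2
    -- Discrete Parseval instead of the triangle inequality: E² then factors out of ∑‖P^{(k)}‖_F² ≤
    -- M², with no count of the modes.
    _ = (N : ℝ) ^ d * ∑ k ∈ symIndexBox d F.modes,
          ‖Matrix.toEuclideanLin (F.mult t k) (fourierCoeff f k - dft v k)‖ ^ 2 :=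
        sum_norm_trigPoly_gridPoint_sq hN0 _
          (fun k hk l hl hkl => eq_of_mem_symIndexBox hN hk hl hkl) _
    _ ≤ ∑ k ∈ symIndexBox d F.modes, frobSq (F.mult t k) * E ^ 2 := by
        rw [Finset.mul_sum]
        refine Finset.sum_le_sum fun k hk => ?_
        have h1 := pow_le_pow_left₀ (by positivity) (hδ k hk) 2
        rw [mul_pow, hD, Real.sq_sqrt (by positivity)] at h1
        calc (N : ℝ) ^ d * ‖Matrix.toEuclideanLin (F.mult t k) (fourierCoeff f k - dft v k)‖ ^ 2
            ≤ (N : ℝ) ^ d * (frobSq (F.mult t k) * ‖fourierCoeff f k - dft v k‖ ^ 2) := by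
              gcongr
              exact norm_toEuclideanLin_sq_le _ _
          _ = frobSq (F.mult t k) * ((N : ℝ) ^ d * ‖fourierCoeff f k - dft v k‖ ^ 2) := by ring
          _ ≤ _ := mul_le_mul_of_nonneg_left h1 (frobSq_nonneg _)
    _ ≤ (M * E) ^ 2 := by
        rw [← Finset.sum_mul, mul_pow]
        exact mul_le_mul_of_nonneg_right (hF.sum_frobSq_mult_le ht) (sq_nonneg _)

theorem Admissible.energy_mult_le {F : Model d da} (hF : F.Admissible s B M) {t : ℕ}
    (ht : t < F.depth) {c : (Fin d → ℤ) → CVec (F.width t)} {R : ℝ} (hc : ∀ S, energy s S c ≤ R) :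
    energy s (symIndexBox d F.modes) (fun k => Matrix.toEuclideanLin (F.mult t k) (c k)) ≤
      M ^ 2 * R := by
  refine le_trans ?_ (mul_le_mul_of_nonneg_left (hc (symIndexBox d F.modes)) (sq_nonneg M))
  rw [energy, energy, Finset.mul_sum]
  refine Finset.sum_le_sum fun k hk => ?_
  rw [mul_left_comm]
  refine mul_le_mul_of_nonneg_left ?_ (pow_nonneg (freqSq_nonneg k) s)
  exact (norm_toEuclideanLin_sq_le _ _).trans
    (mul_le_mul_of_nonneg_right (hF.frobSq_mult_le ht hk) (sq_nonneg _))

/-- Uniform regularity of the states and the discretization error, for inputs of class `Cˢ`. -/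
theorem exists_state_bound (hs : (d : ℝ) / 2 < s) (hB : 0 ≤ B) (M A R : ℝ) (t : ℕ) :
    ∃ A' R' C, 0 ≤ C ∧ ∀ {F : Model d da}, F.Admissible s B M → t ≤ F.depth →
      ∀ {f : Torus d → RVec da}, SobolevBound s A R f → SobolevBound s A' R' (F.state f t) ∧
        ∀ {N : ℕ}, 2 * F.modes < N →
          ell2Norm (fun n : Fin d → Fin N =>
            F.state f t (gridPoint n) - F.gridState N f t n) ≤
              Real.sqrt ((N : ℝ) ^ d) * (C * ((N : ℝ) ^ s)⁻¹) := by
  have hs1 : 1 ≤ s := by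
    have h0 : (0 : ℝ) < s := lt_of_le_of_lt (by positivity) hs
    exact_mod_cast h0
  induction t with
  | zero =>
    obtain ⟨A', R', h⟩ := exists_sobolevBound_comp d hs1 hB (M * A + 0) (2 * (M ^ 2 * R) + 2 * 0)
    refine ⟨A', R', 0, le_rfl, fun {F} hF _ {f} hf => ⟨?_, fun {N} _ => ?_⟩⟩
    · have hL : ‖LinearMap.toContinuousLinearMap (Matrix.toEuclideanLin F.liftMat)‖ ≤ M :=
        ContinuousLinearMap.opNorm_le_bound _ hF.nonneg fun v =>
          norm_toEuclideanLin_le hF.nonneg hF.frobSq_liftMat_le v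
      exact h hF.liftAct_bound ((hf.clm _ hL).add (SobolevBound.const hs1 F.liftBias))
    · have : (fun n : Fin d → Fin N => F.state f 0 (gridPoint n) - F.gridState N f 0 n) =
          fun _ => 0 := funext fun n => sub_self (F.lift (f (gridPoint n)))
      rw [this]
      simp [ell2Norm]
  | succ t ih =>
    obtain ⟨A₁, R₁, C₁, hC₁, ih⟩ := ih
    set R₂ := (d : ℝ) ^ (s - 1) * (d * R₁) with hR₂
    obtain ⟨A₃, R₃, h₃⟩ := exists_sobolevBound_trigPoly (d := d) hs (M ^ 2 * R₂)
    -- The constants have the shape produced by adding the local term, the kernel term and the bias;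
    -- the bias, being constant, contributes zero.
    obtain ⟨A', R', h⟩ := exists_sobolevBound_comp d hs1 hB (M * A₁ + 1 * A₃ + 0)
      (2 * (2 * (M ^ 2 * R₁) + 2 * (1 ^ 2 * R₃)) + 2 * 0)
    obtain ⟨C₂, hC₂, h₂⟩ := exists_ell2Norm_kernel_sub_le (da := da) hs B M R₂
    -- The old error enters twice, through the matrix and through the kernel; C₂ is the new
    -- aliasing. The sign of M is known only once an admissible model is given, hence |M|.
    refine ⟨A', R', B * (|M| * C₁ + |M| * (C₂ + C₁)), by positivity, fun {F} hF ht {f} hf => ?_⟩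
    obtain ⟨hreg, herr⟩ := ih hF (by omega) hf
    have henergy : ∀ S, energy s S (fourierCoeff (F.state f t)) ≤ R₂ :=
      energy_fourierCoeff_le hs1 hreg
    have hker : SobolevBound s (1 * A₃) (1 ^ 2 * R₃) (F.kernel t (F.state f t)) :=
      (h₃ _ _ (hF.energy_mult_le ht henergy)).clm (rePartL _) norm_rePartL_le
    refine ⟨h (hF.act_bound t ht) (((hreg.clm _ (hF.weight_bound t ht)).add hker).add
      (SobolevBound.const hs1 (F.bias t))), fun {N} hN => ?_⟩
    set e : (Fin d → Fin N) → RVec (F.width t) := fun n =>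
      F.state f t (gridPoint n) - F.gridState N f t n with he
    set κ : (Fin d → Fin N) → RVec (F.width (t + 1)) := fun n =>
      F.kernel t (F.state f t) (gridPoint n) - F.gridKernel N t (F.gridState N f t) n with hκ
    have hstep : ∀ n : Fin d → Fin N,
        ‖F.state f (t + 1) (gridPoint n) - F.gridState N f (t + 1) n‖ ≤
          B * ‖Matrix.toEuclideanLin (F.weight t) (e n) + κ n‖ := by
      intro n
      refine ((hF.act_bound t ht).norm_sub_le hs1 _ _).trans (le_of_eq ?_)
      rw [add_sub_add_right_eq_sub, add_sub_add_comm, ← map_sub]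
    have h4 : ell2Norm (fun n => Matrix.toEuclideanLin (F.weight t) (e n)) ≤ M * ell2Norm e :=
      ell2Norm_le_mul hF.nonneg fun n => hF.norm_weight_apply_le ht (e n)
    have h5 : ell2Norm κ ≤ M * (Real.sqrt ((N : ℝ) ^ d) * (C₂ * ((N : ℝ) ^ s)⁻¹) + ell2Norm e) :=
      h₂ hF ht hN hreg.smooth.continuous henergy _
    have h6 := herr hN
    have hM := hF.nonneg
    rw [abs_of_nonneg hM]
    set X := Real.sqrt ((N : ℝ) ^ d)
    set Y := ((N : ℝ) ^ s)⁻¹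
    calc _ ≤ B * ell2Norm (fun n => Matrix.toEuclideanLin (F.weight t) (e n) + κ n) :=
          ell2Norm_le_mul hB hstep
      _ ≤ B * (M * ell2Norm e + M * (X * (C₂ * Y) + ell2Norm e)) := by
          gcongr
          exact (ell2Norm_add_le _ _).trans (add_le_add h4 h5)
      _ ≤ B * (M * (X * (C₁ * Y)) + M * (X * (C₂ * Y) + X * (C₁ * Y))) := by gcongr
      _ = X * (B * (M * C₁ + M * (C₂ + C₁)) * Y) := by ring

end Model

theorem Sobolev.energy_le {m : ℕ} (a : Sobolev d m s) (S : Finset (Fin d → ℤ)) :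
    energy s S (fourierCoeff a.toCont) ≤ ‖a‖ ^ 2 := by
  rw [Sobolev.norm_sq]
  have ha : Summable fun k : Fin d → ℤ => sobolevWeight s k * ‖fourierCoeff a.toCont k‖ ^ 2 := a.2
  refine le_trans (Finset.sum_le_sum fun k _ => ?_) (ha.sum_le_tsum S fun k _ =>
    mul_nonneg (sobolevWeight_pos s k).le (sq_nonneg _))
  refine mul_le_mul_of_nonneg_right ?_ (sq_nonneg _)
  exact le_add_of_nonneg_left zero_le_one

end Model

end

end FNO

/-! ### The discretization error for Sobolev inputs. -/

theorem theorem1 (d da s t : ℕ) (hs : (d : ℝ) / 2 < (s : ℝ)) (B M : ℝ) (hB : 1 ≤ B) (hM : 1 ≤ M)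
    (A : Set (FNO.Sobolev d da s)) (hA : IsCompact A) :
    ∃ C : ℝ, ∀ F : FNO.Model d da, F.Admissible s B M → t ≤ F.depth → 1 ≤ F.modes →
      ∀ N : ℕ, (F.modes : ℝ) < (N : ℝ) / 2 → ∀ a ∈ A,
        1 / (N : ℝ) ^ ((d : ℝ) / 2) *
            FNO.ell2Norm (fun n : Fin d → Fin N =>
              F.state a.toCont t (FNO.gridPoint n) - F.gridState N a.toCont t n) ≤
          C * (N : ℝ) ^ (-(s : ℝ)) := by
  have hs1 : 1 ≤ s := by
    have h0 : (0 : ℝ) < s := lt_of_le_of_lt (by positivity) hs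
    exact_mod_cast h0
  have hB0 : 0 ≤ B := zero_le_one.trans hB
  obtain ⟨R, hR⟩ := hA.isBounded.exists_norm_le
  -- The same A₁ and R₁ serve all partial Fourier sums of all inputs in the set, so C is fixed
  -- before the model, the grid and the approximation.
  obtain ⟨A₁, R₁, h₁⟩ := FNO.exists_sobolevBound_trigPoly (d := d) hs (R ^ 2)
  obtain ⟨_, _, C, hC, h⟩ :=
    FNO.Model.exists_state_bound (da := da) hs hB0 M (1 * A₁) (1 ^ 2 * R₁) t
  refine ⟨C, fun F hF ht _ N hN a ha => ?_⟩
  have hN' : 2 * F.modes < N := by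
    have : (2 * F.modes : ℝ) < N := by linarith
    exact_mod_cast this
  have hN0 : (0 : ℝ) < N := by exact_mod_cast (by omega : 0 < N)
  have henergy : ∀ S, FNO.energy s S (FNO.fourierCoeff a.toCont) ≤ R ^ 2 := fun S =>
    (a.energy_le S).trans (pow_le_pow_left₀ (norm_nonneg _) (hR a ha) 2)
  obtain ⟨L, hL, hlip⟩ := hF.exists_lipschitz hs1 hB0 ht
  set D := Real.sqrt ((N : ℝ) ^ d) with hDdef
  have hD : (N : ℝ) ^ ((d : ℝ) / 2) = D := by
    rw [hDdef, Real.sqrt_eq_rpow, ← Real.rpow_natCast, ← Real.rpow_mul hN0.le]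
    congr 1
    ring
  have hD0 : 0 < D := Real.sqrt_pos.2 (by positivity)
  rw [hD, Real.rpow_neg hN0.le, Real.rpow_natCast, one_div, inv_mul_le_iff₀ hD0]
  have hconv := FNO.tendstoUniformly_trigPoly a.toCont.continuous
    (FNO.summable_norm_of_energy_le hs henergy)
  refine le_of_forall_pos_le_add fun η hη => ?_
  -- Replacing the input by g costs at most D · 2Lε ≤ η in the grid norm, Lε for each of the two
  -- states; the summand 1 only keeps the denominator positive.
  set ε := η / (D * (2 * L) + 1) with hε
  have hε0 : 0 < ε := by positivity
  obtain ⟨S, hS⟩ := (Metric.tendstoUniformly_iff.1 hconv ε hε0).exists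
  -- The finite set S need not be symmetric, so the partial sum may be complex. Taking real parts
  -- does not increase the distance to a real function or the Sobolev bound.
  set g : FNO.Torus d → FNO.RVec da := fun x =>
    FNO.rePartL da (FNO.trigPoly S (FNO.fourierCoeff a.toCont) x) with hg
  have hgb : FNO.SobolevBound s (1 * A₁) (1 ^ 2 * R₁) g :=
    (h₁ S _ (henergy S)).clm (FNO.rePartL da) FNO.norm_rePartL_le
  have hag : ∀ x, ‖a.toCont x - g x‖ ≤ ε := by
    intro x
    have h2 : a.toCont x - g x = FNO.rePart
        (FNO.toC (a.toCont x) - FNO.trigPoly S (FNO.fourierCoeff a.toCont) x) := by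
      rw [← FNO.rePartL_apply, map_sub, FNO.rePartL_apply (FNO.toC _), FNO.rePart_toC]
    rw [h2]
    refine (FNO.Model.norm_rePart_le _).trans ?_
    rw [← dist_eq_norm]
    exact (hS x).le
  obtain ⟨l₁, l₂⟩ := hlip a.toCont.continuous hgb.smooth.continuous hε0.le hag
  obtain ⟨_, herr⟩ := h hF ht hgb
  have hsplit : (fun n : Fin d → Fin N =>
      F.state a.toCont t (FNO.gridPoint n) - F.gridState N a.toCont t n) = fun n =>
      (F.state g t (FNO.gridPoint n) - F.gridState N g t n) +
        ((F.state a.toCont t (FNO.gridPoint n) - F.state g t (FNO.gridPoint n)) -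
          (F.gridState N a.toCont t n - F.gridState N g t n)) := by
    funext n
    abel
  rw [hsplit]
  refine (FNO.ell2Norm_add_le _ _).trans (add_le_add (herr hN') ?_)
  have hsmall : ∀ n : Fin d → Fin N,
      ‖(F.state a.toCont t (FNO.gridPoint n) - F.state g t (FNO.gridPoint n)) -
        (F.gridState N a.toCont t n - F.gridState N g t n)‖ ≤ 2 * L * ε := fun n =>
    (norm_sub_le_of_le (l₁ _) (l₂ N n)).trans (by linarith)
  refine (FNO.ell2Norm_le_of_forall_le (by positivity) hsmall).trans ?_
  rw [← hDdef, ← mul_assoc, hε, mul_div_assoc', div_le_iff₀ (by positivity)]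
  nlinarith
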